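/- Let $Y$ be a (open) three holed sphere with boundary curves $\alpha,\beta,\gamma$, whose homotopy classes are chosen so that $\pi_1(Y)=\langle[\alpha],[\beta],[\gamma] : [\gamma][\beta][\alpha]=1\rangle$. Let $\mathrm{SO}_0(2,1)<\mathrm{SL}(3,\mathbb{R})$ be the identity component of the special orthogonal group of the form $2z_1z_3+z_2^2$ of signature $(2,1)$, acting on the hyperbolic plane $\mathbf{H}^2$ by orientation preserving isometries. Let $\rho:\pi_1(Y)\to\Gamma=\rho(\pi_1(Y))<\mathrm{SO}_0(2,1)$ be a Fuchsian representation, that is, $\Gamma$ acts freely and properly discontinuously on $\mathbf{H}^2$ and there is a homeomorphism $\mathbf{H}^2/\Gamma\to Y$ which induces $\rho$ (that is, $\rho$ is the resulting identification of $\pi_1(Y)$ with the deck group $\Gamma$). Write $A=\rho([\alpha])$, $B=\rho([\beta])$, $C=\rho([\gamma])$, so $CBA=I$, and define the shape invariants $$\sigma_+=\mathrm{tr}(A^{-1}B)-\mathrm{tr}(A^{-1})\,\mathrm{tr}(B),\qquad \sigma_-=\mathrm{tr}(B^{-1}A)-\mathrm{tr}(B^{-1})\,\mathrm{tr}(A).$$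 Then $(\mathrm{tr}(A)+1)(\mathrm{tr}(B)+1)(\mathrm{tr}(C)+1)>0$ and, taking the positive square root and writing $[A,B]=ABA^{-1}B^{-1}$, $$\sigma_+=\sigma_-=\mathrm{tr}(A)+\mathrm{tr}(B)+\mathrm{tr}(C)+1+2\sqrt{(\mathrm{tr}(A)+1)(\mathrm{tr}(B)+1)(\mathrm{tr}(C)+1)},$$ $$\mathrm{tr}[A,B]=\Bigl(\mathrm{tr}(A)+\mathrm{tr}(B)+\mathrm{tr}(C)+1+\sqrt{(\mathrm{tr}(A)+1)(\mathrm{tr}(B)+1)(\mathrm{tr}(C)+1)}\Bigr)^2-1.$$ -/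

import Mathlib

open Matrix Topology

namespace Pants

/-- The symmetric matrix `J` of signature `(2,1)`; the form is `zᵀ J z = 2 z₁ z₃ + z₂²`. -/
def J : Matrix (Fin 3) (Fin 3) ℝ := !![0, 0, 1; 0, 1, 0; 1, 0, 0]

/-- `SO(2,1)`, as the special orthogonal group of `J`. -/
def SO21 : Subgroup (SpecialLinearGroup (Fin 3) ℝ) where
  carrier := {A | A.1ᵀ * J * A.1 = J}
  one_mem' := by simp
  mul_mem' := by
    intro A B hA hB
    change A.1ᵀ * J * A.1 = J at hA
    change B.1ᵀ * J * B.1 = J at hB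
    change (A.1 * B.1)ᵀ * J * (A.1 * B.1) = J
    calc _ = B.1ᵀ * (A.1ᵀ * J * A.1) * B.1 := by
          simp only [transpose_mul, Matrix.mul_assoc]
      _ = J := by rw [hA, hB]
  inv_mem' := by
    intro A hA
    change A.1ᵀ * J * A.1 = J at hA
    have h1 : A.1 * (A⁻¹).1 = 1 := congrArg Subtype.val (mul_inv_cancel A)
    have h2 : (A⁻¹).1ᵀ * A.1ᵀ = 1 := by rw [← transpose_mul, h1, transpose_one]
    change (A⁻¹).1ᵀ * J * (A⁻¹).1 = J
    calc (A⁻¹).1ᵀ * J * (A⁻¹).1 = (A⁻¹).1ᵀ * (A.1ᵀ * J * A.1) * (A⁻¹).1 := by rw [hA]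
      _ = ((A⁻¹).1ᵀ * A.1ᵀ) * J * (A.1 * (A⁻¹).1) := by
          simp only [Matrix.mul_assoc]
      _ = J := by rw [h1, h2, Matrix.one_mul, Matrix.mul_one]

/-- `SO₀(2,1)`, the identity component of `SO(2,1)`. -/
def SO21₀ : Subgroup SO21 := Subgroup.connectedComponentOfOne SO21

/-- The underlying element of `SL(3,ℝ)` of an element of `SO₀(2,1)`. -/
def toSL (A : SO21₀) : SpecialLinearGroup (Fin 3) ℝ := A.1.1

/-- The hyperboloid model of the hyperbolic plane: one sheet of `{z | zᵀ J z = -1}`. -/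
def HypPlane : Type := {z : Fin 3 → ℝ // z ⬝ᵥ (J *ᵥ z) = -1 ∧ 0 < z 2}

instance : TopologicalSpace HypPlane := inferInstanceAs (TopologicalSpace (Subtype _))

theorem last_ne_zero {z : Fin 3 → ℝ} (hz : z ⬝ᵥ (J *ᵥ z) = -1) : z 2 ≠ 0 := by
  intro h
  simp [J, dotProduct, mulVec, Fin.sum_univ_three, h] at hz
  nlinarith [mul_self_nonneg (z 1)]

theorem form_mulVec (A : SO21) (z : Fin 3 → ℝ) :
    (A.1.1 *ᵥ z) ⬝ᵥ (J *ᵥ (A.1.1 *ᵥ z)) = z ⬝ᵥ (J *ᵥ z) := by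
  have hA : A.1.1ᵀ * J * A.1.1 = J := A.2
  rw [mulVec_mulVec, dotProduct_comm, dotProduct_mulVec, ← mulVec_transpose, mulVec_mulVec,
    dotProduct_comm]
  congr 2
  rw [← Matrix.mul_assoc, hA]

/-- The identity component preserves the chosen sheet of the hyperboloid. -/
theorem last_pos (A : SO21₀) (z : HypPlane) : 0 < (A.1.1.1 *ᵥ z.1) 2 := by
  have hc : IsPreconnected (SO21₀ : Set SO21) := isPreconnected_connectedComponent
  have hf : Continuous fun B : SO21 ↦ (B.1.1 *ᵥ z.1) 2 := by
    have : Continuous fun B : SO21 ↦ B.1.1 :=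
      (continuous_subtype_val.comp continuous_subtype_val)
    fun_prop
  have hi := hc.image _ hf.continuousOn
  by_contra hneg
  have h1 : z.1 2 ∈ (fun B : SO21 ↦ (B.1.1 *ᵥ z.1) 2) '' (SO21₀ : Set SO21) :=
    ⟨1, SO21₀.one_mem, by simp⟩
  have h2 : (A.1.1.1 *ᵥ z.1) 2 ∈ (fun B : SO21 ↦ (B.1.1 *ᵥ z.1) 2) '' (SO21₀ : Set SO21) :=
    ⟨A.1, A.2, rfl⟩
  obtain ⟨B, -, hB⟩ := hi.Icc_subset h2 h1 ⟨not_lt.mp hneg, z.2.2.le⟩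
  exact last_ne_zero (form_mulVec B z.1 ▸ z.2.1) hB

/-- The action of `SO₀(2,1)` on the hyperbolic plane by orientation preserving isometries. -/
instance : MulAction SO21₀ HypPlane where
  smul A z := ⟨A.1.1.1 *ᵥ z.1, (form_mulVec A.1 z.1).trans z.2.1, last_pos A z⟩
  one_smul z := Subtype.ext (one_mulVec z.1)
  mul_smul A B z := Subtype.ext (mulVec_mulVec z.1 A.1.1.1 B.1.1.1).symm

/-- The standard (open) three holed sphere: the disc `|z| < 3` in the plane with the two holes
`|z + 1| ≤ 1/2` and `|z - 1| ≤ 1/2` removed. -/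
def stdPants : Set ℂ := {z | ‖z‖ < 3 ∧ 1 / 2 < ‖z + 1‖ ∧ 1 / 2 < ‖z - 1‖}

/-- `Y` is a three holed sphere, and `α`, `β`, `γ` are the homotopy classes of its three boundary
curves, chosen so that `π₁(Y) = ⟨α, β, γ | γ β α = 1⟩`.  That is, some homeomorphism from `Y` to
the standard model carries `α`, `β` to the circles `|z + 1| = 1` and `|z - 1| = 1` through the
base point `0`, each run once anticlockwise (these go around the two inner boundary components),
and `γ` is the inverse of their product (it goes once clockwise around the outer one).
In `FundamentalGroup` the product `β * α` is the class of `α` followed by `β`. -/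
def IsThreeHoledSphere {Y : Type*} [TopologicalSpace Y] {y₀ : Y}
    (α β γ : FundamentalGroup Y y₀) : Prop :=
  ∃ (φ : Y ≃ₜ stdPants) (a b : Path y₀ y₀),
    (∀ t : unitInterval, (φ (a t) : ℂ) = -1 + Complex.exp (2 * Real.pi * (t : ℝ) * Complex.I)) ∧
    (∀ t : unitInterval, (φ (b t) : ℂ) = 1 - Complex.exp (2 * Real.pi * (t : ℝ) * Complex.I)) ∧
    α = FundamentalGroup.fromPath (Path.Homotopic.Quotient.mk a) ∧
    β = FundamentalGroup.fromPath (Path.Homotopic.Quotient.mk b) ∧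
    γ * β * α = 1

/-- The projection from the hyperbolic plane to its quotient by `Γ`. -/
abbrev proj (Γ : Subgroup SO21₀) : HypPlane → Quotient (MulAction.orbitRel Γ HypPlane) :=
  Quotient.mk (MulAction.orbitRel Γ HypPlane)

/-- `ρ : π₁(Y) → Γ < SO₀(2,1)` is a Fuchsian representation: `Γ` acts freely and properly
discontinuously on the hyperbolic plane (as a covering group), and there is a homeomorphism `f`
from the quotient by `Γ` to `Y` that induces `ρ`, i.e. `ρ` is the identification of `π₁(Y)` with the
group of deck transformations `Γ`: for every `g` in `π₁(Y)`, the loop `g` is the image of a path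
joining `x₀` and `ρ(g) x₀`.  The path runs from `ρ(g) x₀` to `x₀` because `g * h` is `h` followed
by `g` in `FundamentalGroup`.  (Such a `ρ` is faithful with discrete image.) -/
def IsFuchsian {Y : Type*} [TopologicalSpace Y] {y₀ : Y}
    (ρ : FundamentalGroup Y y₀ →* SO21₀) : Prop :=
  IsQuotientCoveringMap (proj ρ.range) ρ.range ∧
  ∃ (f : Quotient (MulAction.orbitRel ρ.range HypPlane) ≃ₜ Y) (x₀ : HypPlane),
    f (proj ρ.range x₀) = y₀ ∧
    ∀ g : FundamentalGroup Y y₀, ∃ (c : Path (ρ g • x₀) x₀) (d : Path y₀ y₀),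
      (∀ t, d t = f (proj ρ.range (c t))) ∧
      FundamentalGroup.fromPath (Path.Homotopic.Quotient.mk d) = g

/-- The trace of an element of `SL(3,R)`. -/
def tr {R : Type*} [CommRing R] (A : SpecialLinearGroup (Fin 3) R) : R := A.1.trace

/-- The shape invariant `σ₊` of a triple with `C B A = I`. -/
def shapePlus {R : Type*} [CommRing R] (A B _C : SpecialLinearGroup (Fin 3) R) : R :=
  tr (A⁻¹ * B) - tr A⁻¹ * tr B

/-- The shape invariant `σ₋` of a triple with `C B A = I`. -/
def shapeMinus {R : Type*} [CommRing R] (A B _C : SpecialLinearGroup (Fin 3) R) : R :=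
  tr (B⁻¹ * A) - tr B⁻¹ * tr A

end Pants

/-!
The universal covering of the standard three holed sphere, composed with the inclusion in the plane,
is a locally injective map `F : ℍ → ℂ`. Near the diagonal the quotient of `F q - F p` by the
coordinate of `q` in the tangent space at `p` does not vanish, and it has a continuous square root
`h`, which behaves like a half-integral weight form: a deck transformation multiplies it by plus or
minus the automorphy factor `c z + d`. Requiring the sign to be plus selects a lift of the deck
transformation to `SL(2, ℝ)`, and these lifts are multiplicative.

Each of the three boundary curves is freely homotopic to a round circle. As a chord of a circle
turns half as fast as its endpoint, following `h` once around the circle shows that the selected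
lift of the holonomy has negative trace. Hence `ρ α`, `ρ β` are the symmetric squares of `a`, `b`
with `tr a`, `tr b`, `tr (b a)` all negative. Fricke's identities express the traces in question as
polynomials in these three numbers, and the positive square root is `- tr a * tr b * tr (b a)`.
-/

namespace Pants

open UpperHalfPlane ComplexConjugate Matrix.SpecialLinearGroup

section Moebius

variable (g : SpecialLinearGroup (Fin 2) ℝ) (p q : ℍ)

theorem det_fin_two_eq_one : g.1 0 0 * g.1 1 1 - g.1 0 1 * g.1 1 0 = 1 := by
  rw [← det_fin_two, g.2]

theorem denom_eq : denom g p = g.1 1 0 * p + g.1 1 1 := rfl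

theorem continuous_denom : Continuous fun p : ℍ => denom g p := by
  have := UpperHalfPlane.continuous_coe
  unfold denom
  fun_prop

theorem denom_mul (h : SpecialLinearGroup (Fin 2) ℝ) :
    denom (toGL (g * h)) p = denom g (h • p : ℍ) * denom h p := by
  rw [map_mul, denom_cocycle g h p.im_ne_zero, ← coe_smul_of_det_pos (by simp) p]
  rfl

theorem toGL_neg : toGL (-g) = -toGL g := by
  ext i j
  simp

theorem neg_smul_eq_smul : -g • p = g • p := by
  change toGL (-g) • p = toGL g • p
  rw [toGL_neg, UpperHalfPlane.neg_smul]

theorem coe_smul_mul_denom : ((g • p : ℍ) : ℂ) * denom g p = g.1 0 0 * p + g.1 0 1 := by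
  rw [show ((g • p : ℍ) : ℂ) = (g.1 0 0 * p + g.1 0 1) / denom g p from
    coe_specialLinearGroup_apply g p, div_mul_cancel₀ _ (denom_ne_zero g p)]

theorem im_smul_eq_div : (g • p : ℍ).im = p.im / ‖denom g p‖ ^ 2 := by
  have := UpperHalfPlane.im_smul_eq_div_normSq (g : GL (Fin 2) ℝ) p
  rwa [Complex.normSq_eq_norm_sq, coeToGL_det, Units.val_one, abs_one, one_mul] at this

theorem coe_smul_sub_coe_smul :
    ((g • q : ℍ) - (g • p : ℍ) : ℂ) = (q - p) / (denom g p * denom g q) := by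
  rw [eq_div_iff (mul_ne_zero (denom_ne_zero g p) (denom_ne_zero g q))]
  have det : (g.1 0 0 * g.1 1 1 - g.1 0 1 * g.1 1 0 : ℂ) = 1 := by
    exact_mod_cast det_fin_two_eq_one g
  linear_combination (denom g p) * coe_smul_mul_denom g q - (denom g q) * coe_smul_mul_denom g p
    + (q - p : ℂ) * det + (g.1 0 0 * q + g.1 0 1 : ℂ) * denom_eq g p
    - (g.1 0 0 * p + g.1 0 1 : ℂ) * denom_eq g q

theorem coe_smul_sub_conj_coe_smul :
    ((g • q : ℍ) - conj ((g • p : ℍ) : ℂ)) =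
      (q - conj (p : ℂ)) / (conj (denom g p) * denom g q) := by
  rw [eq_div_iff (mul_ne_zero (by simp [denom_ne_zero g p]) (denom_ne_zero g q))]
  have det : (g.1 0 0 * g.1 1 1 - g.1 0 1 * g.1 1 0 : ℂ) = 1 := by
    exact_mod_cast det_fin_two_eq_one g
  have numerator := congrArg conj (coe_smul_mul_denom g p)
  have denominator := congrArg conj (denom_eq g p)
  simp only [map_mul, map_add, Complex.conj_ofReal] at numerator denominator
  linear_combination conj (denom g p) * coe_smul_mul_denom g q - (denom g q) * numerator
    + (q - conj (p : ℂ)) * det + (g.1 0 0 * q + g.1 0 1 : ℂ) * denominator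
    - (g.1 0 0 * conj (p : ℂ) + g.1 0 1 : ℂ) * denom_eq g q

end Moebius

theorem coe_sub_conj_ne_zero (p q : ℍ) : (q : ℂ) - conj (p : ℂ) ≠ 0 := by
  refine fun h => (add_pos q.im_pos p.im_pos).ne' ?_
  simpa using congrArg Complex.im h

/-- The coordinate of `q` in the Poincaré disc centred at `p`. -/
noncomputable def discCoord (p q : ℍ) : ℂ := (q - p) / (q - conj (p : ℂ))

/-- The disc coordinate of `q` centred at `p`, scaled so that an isometry acts on it through its
derivative at `p`: it stands for a tangent vector at `p` pointing towards `q`. -/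
noncomputable def tangentCoord (p q : ℍ) : ℂ := p.im * discCoord p q

theorem discCoord_eq_zero {p q : ℍ} : discCoord p q = 0 ↔ p = q := by
  rw [discCoord, div_eq_zero_iff, or_iff_left (coe_sub_conj_ne_zero p q), sub_eq_zero, coe_inj,
    eq_comm]

theorem tangentCoord_ne_zero {p q : ℍ} (h : p ≠ q) : tangentCoord p q ≠ 0 :=
  mul_ne_zero (Complex.ofReal_ne_zero.2 p.im_ne_zero) (discCoord_eq_zero.not.2 h)

theorem tangentCoord_smul (g : SpecialLinearGroup (Fin 2) ℝ) (p q : ℍ) :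
    tangentCoord (g • p) (g • q) * denom g p ^ 2 = tangentCoord p q := by
  have hp := denom_ne_zero g p
  have hq := denom_ne_zero g q
  have hp' : conj (denom g p) ≠ 0 := by simp [hp]
  have hpq := coe_sub_conj_ne_zero p q
  rw [tangentCoord, tangentCoord, discCoord, discCoord, im_smul_eq_div, coe_smul_sub_coe_smul,
    coe_smul_sub_conj_coe_smul]
  push_cast
  rw [← Complex.mul_conj']
  field_simp

theorem norm_discCoord (p q : ℍ) : ‖discCoord p q‖ = Real.tanh (dist p q / 2) := by
  rw [UpperHalfPlane.dist_comm, UpperHalfPlane.tanh_half_dist, discCoord, norm_div,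
    dist_eq_norm, dist_eq_norm]

theorem norm_discCoord_lt_one (p q : ℍ) : ‖discCoord p q‖ < 1 :=
  norm_discCoord p q ▸ Real.tanh_lt_one _

theorem continuous_discCoord : Continuous fun x : ℍ × ℍ => discCoord x.1 x.2 := by
  have := UpperHalfPlane.continuous_coe
  have := Complex.continuous_conj
  unfold discCoord
  exact Continuous.div (by fun_prop) (by fun_prop) fun x => coe_sub_conj_ne_zero _ _

theorem continuous_tangentCoord : Continuous fun x : ℍ × ℍ => tangentCoord x.1 x.2 := by
  have := UpperHalfPlane.continuous_im
  have := continuous_discCoord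
  unfold tangentCoord
  fun_prop

/-- The point whose coordinate in the Poincaré disc centred at `p` is `w` (when `‖w‖ < 1`). -/
noncomputable def discPoint (p : ℍ) (w : ℂ) : ℍ := ofComplex ((p - w * conj (p : ℂ)) / (1 - w))

theorem one_sub_ne_zero_of_norm_lt_one {w : ℂ} (hw : ‖w‖ < 1) : 1 - w ≠ 0 :=
  sub_ne_zero.2 fun h => hw.ne (by rw [← h, norm_one])

theorem discPoint_im_pos (p : ℍ) {w : ℂ} (hw : ‖w‖ < 1) :
    0 < (((p : ℂ) - w * conj (p : ℂ)) / (1 - w)).im := by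
  have normSq_lt : Complex.normSq w < 1 := by
    rw [Complex.normSq_eq_norm_sq]
    exact pow_lt_one₀ (norm_nonneg w) hw two_ne_zero
  have im_eq : (((p : ℂ) - w * conj (p : ℂ)) / (1 - w)).im
      = p.im * (1 - Complex.normSq w) / Complex.normSq (1 - w) := by
    rw [Complex.div_im, ← sub_div, Complex.normSq_apply w]
    simp
    ring
  rw [im_eq]
  exact div_pos (mul_pos p.im_pos (sub_pos.2 normSq_lt))
    (Complex.normSq_pos.2 (one_sub_ne_zero_of_norm_lt_one hw))

theorem coe_discPoint (p : ℍ) {w : ℂ} (hw : ‖w‖ < 1) :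
    (discPoint p w : ℂ) = (p - w * conj (p : ℂ)) / (1 - w) := by
  rw [discPoint, ofComplex_apply_of_im_pos (discPoint_im_pos p hw)]

theorem discPoint_zero (p : ℍ) : discPoint p 0 = p := by
  simp [discPoint, ofComplex_apply]

theorem discCoord_discPoint (p : ℍ) {w : ℂ} (hw : ‖w‖ < 1) :
    discCoord p (discPoint p w) = w := by
  have h1 := one_sub_ne_zero_of_norm_lt_one hw
  have := coe_sub_conj_ne_zero p p
  rw [discCoord, div_eq_iff (coe_sub_conj_ne_zero _ _), coe_discPoint p hw]
  field_simp
  ring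

theorem discPoint_discCoord (p q : ℍ) : discPoint p (discCoord p q) = q := by
  have hw := norm_discCoord_lt_one p q
  have h1 := one_sub_ne_zero_of_norm_lt_one hw
  have h2 := coe_sub_conj_ne_zero p q
  apply UpperHalfPlane.ext
  rw [coe_discPoint p hw, div_eq_iff h1, discCoord]
  field_simp
  ring

theorem continuousOn_discPoint :
    ContinuousOn (fun x : ℍ × ℂ => discPoint x.1 x.2) {x | ‖x.2‖ < 1} := by
  rw [isEmbedding_coe.continuousOn_iff]
  have := UpperHalfPlane.continuous_coe
  have := Complex.continuous_conj
  refine ContinuousOn.congr (f := fun x : ℍ × ℂ => (x.1 - x.2 * conj (x.1 : ℂ)) / (1 - x.2))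
    (ContinuousOn.div (by fun_prop) (by fun_prop)
      fun x hx => one_sub_ne_zero_of_norm_lt_one hx) fun x hx => coe_discPoint x.1 hx

theorem injOn_discPoint (p : ℍ) : Set.InjOn (discPoint p) {w | ‖w‖ < 1} :=
  Set.LeftInvOn.injOn fun _ hw => discCoord_discPoint p hw

section SquareRoots

variable {X : Type*} [TopologicalSpace X]

theorem exists_log [SimplyConnectedSpace X] [LocallyPathConnectedSpace X] {f : X → ℂ}
    (hf : Continuous f) (h0 : ∀ x, f x ≠ 0) :
    ∃ L : X → ℂ, Continuous L ∧ ∀ x, Complex.exp (L x) = f x := by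
  obtain ⟨x₀⟩ := (inferInstance : Nonempty X)
  obtain ⟨L, ⟨-, hL⟩, -⟩ := Complex.isCoveringMap_exp.existsUnique_continuousMap_lifts
    ⟨fun x => (⟨f x, h0 x⟩ : {z : ℂ // z ≠ 0}), by fun_prop⟩ x₀ (Complex.log (f x₀))
    (Subtype.ext (Complex.exp_log (h0 x₀)))
  exact ⟨L, L.continuous, fun x => congrArg Subtype.val (congrFun hL x)⟩

theorem exists_sqrt [SimplyConnectedSpace X] [LocallyPathConnectedSpace X] {f : X → ℂ}
    (hf : Continuous f) (h0 : ∀ x, f x ≠ 0) :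
    ∃ k : X → ℂ, Continuous k ∧ ∀ x, k x ^ 2 = f x := by
  obtain ⟨L, hL, h⟩ := exists_log hf h0
  refine ⟨fun x => Complex.exp (L x / 2), by fun_prop, fun x => ?_⟩
  rw [← h, ← Complex.exp_nat_mul]
  congr 1
  push_cast
  ring

theorem simplyConnectedSpace_prod {Y : Type*} [TopologicalSpace Y] [SimplyConnectedSpace X]
    [SimplyConnectedSpace Y] : SimplyConnectedSpace (X × Y) := by
  refine simply_connected_iff_paths_homotopic.2 ⟨inferInstance, fun x y => ⟨fun a b => ?_⟩⟩
  rw [← Path.Homotopic.prod_projLeft_projRight a, ← Path.Homotopic.prod_projLeft_projRight b]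
  congr 1 <;> exact Subsingleton.elim _ _

theorem exists_const_ratio [PreconnectedSpace X] {u v : X → ℂ} (hu : Continuous u)
    (hv : Continuous v) (h0 : ∀ x, v x ≠ 0) {c : ℂ} (hc : c ≠ 0)
    (h : ∀ x, u x ^ 2 = c * v x ^ 2) : ∃ ε : ℂ, ε ^ 2 = c ∧ ∀ x, u x = ε * v x := by
  obtain ⟨d, rfl⟩ := IsAlgClosed.exists_pow_nat_eq c (n := 2) two_pos
  have hd : d ≠ 0 := fun h => hc (by simp [h])
  rcases isPreconnected_univ.eq_or_eq_neg_of_sq_eq (f := u) (g := fun x => d * v x)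
    hu.continuousOn (by fun_prop) (fun x _ => by simp [h x, mul_pow])
    (fun {x} _ => mul_ne_zero hd (h0 x)) with same | opposite
  · exact ⟨d, rfl, fun x => same (Set.mem_univ x)⟩
  · exact ⟨-d, neg_sq d, fun x => by simpa using opposite (Set.mem_univ x)⟩

theorem comp_comp_eq_neg_of_sq_comp_eq_neg_sq [PreconnectedSpace X] {k : X → ℂ} {T : X → X}
    (hk : Continuous k) (hT : Continuous T) (h0 : ∀ x, k x ≠ 0)
    (h : ∀ x, k (T x) ^ 2 = -k x ^ 2) (x : X) : k (T (T x)) = -k x := by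
  obtain ⟨ε, hε, hkT⟩ := exists_const_ratio (hk.comp hT) hk h0 (c := -1) (by simp)
    (fun x => by simpa using h x)
  calc k (T (T x)) = ε ^ 2 * k x := by rw [sq, mul_assoc, ← hkT x]; exact hkT (T x)
    _ = -k x := by rw [hε, neg_one_mul]

theorem continuousAt_extend {Y Z : Type*} [TopologicalSpace Y] [TopologicalSpace Z]
    {ψ : X → Y} {g : X → Z} (hψ : Continuous ψ) (hopen : IsOpenMap ψ) (hg : Continuous g)
    (hfactor : g.FactorsThrough ψ) (e : Y → Z) (x : X) :
    ContinuousAt (Function.extend ψ g e) (ψ x) := by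
  rw [ContinuousAt, ← hopen.map_nhds_eq hψ.continuousAt, Filter.tendsto_map'_iff,
    hfactor.extend_apply]
  exact hg.continuousAt.tendsto.congr fun y => (hfactor.extend_apply e y).symm

theorem norm_exp_I_mul_lt_one (z : ℍ) : ‖Complex.exp (Complex.I * z)‖ < 1 := by
  rw [Complex.norm_exp]
  simpa using z.im_pos

theorem norm_ofReal_mul_exp_lt_one {r : ℝ} (hr : |r| ≤ 1) (z : ℍ) :
    ‖(r : ℂ) * Complex.exp (Complex.I * z)‖ < 1 := by
  rw [norm_mul, Complex.norm_real]
  exact mul_lt_one_of_nonneg_of_lt_one_right hr (norm_nonneg _) (norm_exp_I_mul_lt_one z)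

theorem exists_exp_I_mul_eq {ζ : ℂ} (h0 : ζ ≠ 0) (h1 : ‖ζ‖ < 1) :
    ∃ z : ℍ, Complex.exp (Complex.I * z) = ζ := by
  refine ⟨⟨-Complex.I * Complex.log ζ, ?_⟩, ?_⟩
  · simpa [Complex.log_re] using Real.log_neg (norm_pos_iff.2 h0) h1
  · change Complex.exp (Complex.I * (-Complex.I * Complex.log ζ)) = ζ
    rw [← mul_assoc, mul_neg, Complex.I_mul_I, neg_neg, one_mul, Complex.exp_log h0]

theorem exp_I_mul_vadd (t : ℝ) (z : ℍ) :
    Complex.exp (Complex.I * (t +ᵥ z : ℍ)) =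
      Complex.exp (t * Complex.I) * Complex.exp (Complex.I * z) := by
  rw [coe_vadd, mul_add, Complex.exp_add, mul_comm Complex.I (t : ℂ)]

theorem isOpenMap_exp_I_mul : IsOpenMap fun z : ℍ => Complex.exp (Complex.I * z) :=
  (Complex.isOpenMap_exp.comp (Homeomorph.mulLeft₀ Complex.I Complex.I_ne_zero).isOpenMap).comp
    isOpenEmbedding_coe.isOpenMap

theorem factorsThrough_exp_I_mul {E Z : Type*} {H : E × ℍ → Z}
    (h : ∀ x z, H (x, (2 * Real.pi) +ᵥ z) = H (x, z)) :
    H.FactorsThrough (Prod.map id fun z : ℍ => Complex.exp (Complex.I * z)) := by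
  have periodic (x z) : Function.Periodic (fun t : ℝ => H (x, t +ᵥ z)) (2 * Real.pi) := fun t => by
    simp only [add_comm t, add_vadd, h]
  rintro ⟨x, z⟩ ⟨x', z'⟩ heq
  obtain ⟨rfl : x = x', heq⟩ := Prod.ext_iff.1 heq
  obtain ⟨n, hn⟩ := Complex.exp_eq_exp_iff_exists_int.1 heq
  have hz : z = (n * (2 * Real.pi)) +ᵥ z' := UpperHalfPlane.ext <| by
    apply mul_left_cancel₀ Complex.I_ne_zero
    rw [hn, coe_vadd]
    push_cast
    ring
  rw [hz]
  simpa using (periodic x z').int_mul n 0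

variable [SimplyConnectedSpace X] [LocallyPathConnectedSpace X] {Φ : X → ℂ → ℂ}

theorem exists_sqrt_segment
    (hΦ : ContinuousOn (fun y : X × ℂ => Φ y.1 y.2) {y | ‖y.2‖ < 1})
    (hinj : ∀ x, Set.InjOn (Φ x) {ζ | ‖ζ‖ < 1}) :
    ∃ k : X × ℝ × ℍ → ℂ, Continuous k ∧ (∀ y, k y ≠ 0) ∧ ∀ x θ z, k (x, θ, z) ^ 2 =
      Φ x ((Real.cos θ ^ 2 : ℝ) * Complex.exp (Complex.I * z))
        - Φ x ((-Real.sin θ ^ 2 : ℝ) * Complex.exp (Complex.I * z)) := by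
  have := UpperHalfPlane.continuous_coe
  set lower : X × ℝ × ℍ → ℂ := fun y =>
    (-Real.sin y.2.1 ^ 2 : ℝ) * Complex.exp (Complex.I * y.2.2)
  set upper : X × ℝ × ℍ → ℂ := fun y =>
    (Real.cos y.2.1 ^ 2 : ℝ) * Complex.exp (Complex.I * y.2.2)
  have norm_lower (y) : ‖lower y‖ < 1 :=
    norm_ofReal_mul_exp_lt_one (by simpa using Real.abs_sin_le_one _) _
  have norm_upper (y) : ‖upper y‖ < 1 :=
    norm_ofReal_mul_exp_lt_one (by simpa using Real.abs_cos_le_one _) _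
  have hlower : Continuous fun y => Φ y.1 (lower y) :=
    hΦ.comp_continuous (continuous_fst.prodMk (by fun_prop)) norm_lower
  have hupper : Continuous fun y => Φ y.1 (upper y) :=
    hΦ.comp_continuous (continuous_fst.prodMk (by fun_prop)) norm_upper
  have hne (y) : Φ y.1 (upper y) - Φ y.1 (lower y) ≠ 0 := fun h => by
    have ends_eq := hinj y.1 (norm_upper y) (norm_lower y) (sub_eq_zero.1 h)
    have cos_sq := Complex.ofReal_injective (mul_right_cancel₀ (Complex.exp_ne_zero _) ends_eq)
    linarith [Real.sin_sq_add_cos_sq y.2.1]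
  have := simplyConnectedSpace_prod (X := X) (Y := ℝ × ℍ)
  obtain ⟨k, hk, hsq⟩ := exists_sqrt (f := fun y => Φ y.1 (upper y) - Φ y.1 (lower y))
    (hupper.sub hlower) hne
  exact ⟨k, hk, fun y h => hne y (by rw [← hsq, h, zero_pow two_ne_zero]),
    fun x θ z => hsq (x, θ, z)⟩

/-- The segment from `0` to `ζ = exp (I * z)` is slid along itself until its midpoint is `0`; in
that position a half turn exchanges its ends. -/
theorem exists_antiperiodic_sqrt_sub
    (hΦ : ContinuousOn (fun y : X × ℂ => Φ y.1 y.2) {y | ‖y.2‖ < 1})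
    (hinj : ∀ x, Set.InjOn (Φ x) {ζ | ‖ζ‖ < 1}) :
    ∃ k : X × ℍ → ℂ, Continuous k ∧
      (∀ x z, k (x, z) ^ 2 = Φ x (Complex.exp (Complex.I * z)) - Φ x 0) ∧
      ∀ x z, k (x, (2 * Real.pi) +ᵥ z) = -k (x, z) := by
  obtain ⟨k, hk, hk0, hsq⟩ := exists_sqrt_segment hΦ hinj
  set T : X × ℝ × ℍ → X × ℝ × ℍ := fun y => (y.1, Real.pi / 2 - y.2.1, Real.pi +ᵥ y.2.2)
  have hvadd : Continuous fun z : ℍ => Real.pi +ᵥ z := (isometry_real_vadd _).continuous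
  have hT : Continuous T := by fun_prop
  have hsq_T (y) : k (T y) ^ 2 = -k y ^ 2 := by
    rw [hsq, hsq y.1 y.2.1 y.2.2, neg_sub, exp_I_mul_vadd, Complex.exp_pi_mul_I,
      Real.cos_pi_div_two_sub, Real.sin_pi_div_two_sub]
    push_cast
    ring_nf
  refine ⟨fun y => k (y.1, 0, y.2), by fun_prop, fun x z => ?_, fun x z => ?_⟩
  · simp [hsq]
  · have := comp_comp_eq_neg_of_sq_comp_eq_neg_sq hk hT hk0 hsq_T (x, 0, z)
    simpa only [T, sub_sub_cancel, vadd_vadd, ← two_mul] using this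

theorem exists_sqrt_sub_div
    (hΦ : ContinuousOn (fun y : X × ℂ => Φ y.1 y.2) {y | ‖y.2‖ < 1})
    (hinj : ∀ x, Set.InjOn (Φ x) {ζ | ‖ζ‖ < 1}) :
    ∃ h : X × ℂ → ℂ, ContinuousOn h {y | y.2 ≠ 0 ∧ ‖y.2‖ < 1} ∧
      ∀ x ζ, ζ ≠ 0 → ‖ζ‖ < 1 → h (x, ζ) ^ 2 * ζ = Φ x ζ - Φ x 0 := by
  obtain ⟨k, hk, hsq, hanti⟩ := exists_antiperiodic_sqrt_sub hΦ hinj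
  have := UpperHalfPlane.continuous_coe
  set H : X × ℍ → ℂ := fun y => k y / Complex.exp (Complex.I * y.2 / 2) with hH
  have hHc : Continuous H := hk.div (by fun_prop) fun _ => Complex.exp_ne_zero _
  have H_sq (x z) : H (x, z) ^ 2 * Complex.exp (Complex.I * z)
      = Φ x (Complex.exp (Complex.I * z)) - Φ x 0 := by
    have half : Complex.exp (Complex.I * z / 2) ^ 2 = Complex.exp (Complex.I * z) := by
      rw [← Complex.exp_nat_mul]; congr 1; push_cast; ring
    rw [div_pow, half, hsq, div_mul_cancel₀ _ (Complex.exp_ne_zero _)]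
  have H_periodic (x z) : H (x, (2 * Real.pi) +ᵥ z) = H (x, z) := by
    have half : Complex.exp (Complex.I * ((2 * Real.pi) +ᵥ z : ℍ) / 2)
        = -Complex.exp (Complex.I * z / 2) := by
      rw [coe_vadd, ← neg_one_mul, ← Complex.exp_pi_mul_I, ← Complex.exp_add]
      congr 1; push_cast; ring
    simp only [hH, hanti, half, neg_div_neg_eq]
  set ψ : X × ℍ → X × ℂ := Prod.map id fun z : ℍ => Complex.exp (Complex.I * z)
  have hψ : Continuous ψ := by fun_prop
  have hfactor : H.FactorsThrough ψ := factorsThrough_exp_I_mul H_periodic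
  refine ⟨Function.extend ψ H 0, ?_, fun x ζ h0 h1 => ?_⟩
  · rintro ⟨x, ζ⟩ ⟨h0, h1⟩
    obtain ⟨z, rfl⟩ := exists_exp_I_mul_eq h0 h1
    exact (continuousAt_extend hψ (.prodMap .id isOpenMap_exp_I_mul) hHc hfactor 0
      (x, z)).continuousWithinAt
  · obtain ⟨z, rfl⟩ := exists_exp_I_mul_eq h0 h1
    rw [← H_sq x z, ← hfactor.extend_apply 0 (x, z)]
    rfl

end SquareRoots

/-- The injectivity radius of `F`, truncated at one. -/
noncomputable def injRadius {X Z : Type*} [PseudoMetricSpace X] (F : X → Z) (p : X) : ℝ :=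
  sSup {r | 0 ≤ r ∧ r ≤ 1 ∧ Set.InjOn F (Metric.ball p r)}

section injRadius

variable {X Z : Type*} [PseudoMetricSpace X] {F : X → Z}

theorem bddAbove_injRadius (p : X) :
    BddAbove {r | 0 ≤ r ∧ r ≤ 1 ∧ Set.InjOn F (Metric.ball p r)} := ⟨1, fun _ hr => hr.2.1⟩

theorem zero_mem_injRadius (p : X) :
    (0 : ℝ) ∈ {r | 0 ≤ r ∧ r ≤ 1 ∧ Set.InjOn F (Metric.ball p r)} :=
  ⟨le_rfl, zero_le_one, by simp⟩

theorem injRadius_nonneg (p : X) : 0 ≤ injRadius F p :=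
  le_csSup (bddAbove_injRadius p) (zero_mem_injRadius p)

theorem injRadius_le_one (p : X) : injRadius F p ≤ 1 :=
  csSup_le ⟨0, zero_mem_injRadius p⟩ fun _ hr => hr.2.1

theorem injOn_ball_injRadius (p : X) : Set.InjOn F (Metric.ball p (injRadius F p)) := by
  intro q hq q' hq' h
  obtain ⟨r, hr, hlt⟩ := exists_lt_of_lt_csSup ⟨0, zero_mem_injRadius p⟩
    (max_lt (Metric.mem_ball.1 hq) (Metric.mem_ball.1 hq'))
  exact hr.2.2 (Metric.mem_ball.2 ((le_max_left _ _).trans_lt hlt))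
    (Metric.mem_ball.2 ((le_max_right _ _).trans_lt hlt)) h

theorem injRadius_pos (hF : ∀ p, ∃ U ∈ 𝓝 p, Set.InjOn F U) (p : X) : 0 < injRadius F p := by
  obtain ⟨U, hU, hinj⟩ := hF p
  obtain ⟨r, hr, hrU⟩ := Metric.mem_nhds_iff.1 hU
  refine (lt_min hr one_pos).trans_le (le_csSup (bddAbove_injRadius p)
    ⟨(lt_min hr one_pos).le, min_le_right _ _, hinj.mono
      ((Metric.ball_subset_ball (min_le_left _ _)).trans hrU)⟩)

theorem continuous_injRadius : Continuous (injRadius F) := by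
  refine (LipschitzWith.of_le_add fun p q => ?_).continuous
  rw [← sub_le_iff_le_add]
  rcases le_total (injRadius F p - dist p q) 0 with h | h
  · exact h.trans (injRadius_nonneg q)
  · refine le_csSup (bddAbove_injRadius q) ⟨h, ?_, (injOn_ball_injRadius p).mono ?_⟩
    · linarith [injRadius_le_one (F := F) p, dist_nonneg (x := p) (y := q)]
    · apply Metric.ball_subset_ball'
      rw [dist_comm q p]
      linarith

theorem injRadius_smul {G : Type*} [Group G] [MulAction G X] [IsIsometricSMul G X] {g : G}
    (hg : ∀ p, F (g • p) = F p) (p : X) : injRadius F (g • p) = injRadius F p := by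
  unfold injRadius
  congr 1
  ext r
  simp only [Set.mem_ofPred]
  refine and_congr_right fun _ => and_congr_right fun _ => ⟨fun h q hq q' hq' e => ?_,
    fun h q hq q' hq' e => ?_⟩
  · apply smul_left_cancel g
    exact h (by simpa [Metric.mem_ball, dist_smul] using hq)
      (by simpa [Metric.mem_ball, dist_smul] using hq') (by rw [hg, hg, e])
  · apply smul_left_cancel g⁻¹
    refine h ?_ ?_ ?_
    · rw [Metric.mem_ball, ← dist_smul g, smul_inv_smul]; exact hq
    · rw [Metric.mem_ball, ← dist_smul g, smul_inv_smul]; exact hq'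
    · rw [← hg, smul_inv_smul, e, ← hg (g⁻¹ • q'), smul_inv_smul]

end injRadius

section SpinRoots

variable {F : ℍ → ℂ} {h : ℍ × ℍ → ℂ} {g g' : SpecialLinearGroup (Fin 2) ℝ}

/-- The Euclidean radius, in the Poincaré disc centred at `p`, of the ball of radius
`injRadius F p`. -/
noncomputable def discRadius (F : ℍ → ℂ) (p : ℍ) : ℝ := Real.tanh (injRadius F p / 2)

theorem continuous_discRadius : Continuous (discRadius F) := by
  have hinj := continuous_injRadius (F := F)
  rw [show discRadius F = fun p => Real.sinh (injRadius F p / 2) / Real.cosh (injRadius F p / 2)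
    from funext fun _ => Real.tanh_eq_sinh_div_cosh _]
  exact Continuous.div (by fun_prop) (by fun_prop) fun _ => (Real.cosh_pos _).ne'

theorem discRadius_pos (hloc : ∀ p, ∃ U ∈ 𝓝 p, Set.InjOn F U) (p : ℍ) : 0 < discRadius F p := by
  rw [discRadius, Real.tanh_eq_sinh_div_cosh]
  exact div_pos (Real.sinh_pos_iff.2 (half_pos (injRadius_pos hloc p))) (Real.cosh_pos _)

theorem norm_discCoord_lt_discRadius {p q : ℍ} :
    ‖discCoord p q‖ < discRadius F p ↔ dist p q < injRadius F p := by
  have bounds (x : ℝ) : Real.tanh x ∈ Set.Ioo (-1 : ℝ) 1 :=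
    ⟨Real.neg_one_lt_tanh x, Real.tanh_lt_one x⟩
  rw [norm_discCoord, discRadius, ← Real.artanh_lt_artanh_iff (bounds _) (bounds _),
    Real.artanh_tanh, Real.artanh_tanh, div_lt_div_iff_of_pos_right two_pos]

theorem norm_discRadius_mul_lt_one (p : ℍ) {ζ : ℂ} (hζ : ‖ζ‖ < 1) :
    ‖discRadius F p * ζ‖ < 1 := by
  rw [norm_mul, Complex.norm_real]
  exact mul_lt_one_of_nonneg_of_lt_one_right
    (abs_le.2 ⟨(Real.neg_one_lt_tanh _).le, (Real.tanh_lt_one _).le⟩) (norm_nonneg ζ) hζ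

/-- The pairs of distinct points so close to each other that `F` separates them. -/
def nearPairs (F : ℍ → ℂ) : Set (ℍ × ℍ) :=
  {x | x.1 ≠ x.2 ∧ dist x.1 x.2 < injRadius F x.1}

theorem map_ne_of_mem_nearPairs {x : ℍ × ℍ} (hx : x ∈ nearPairs F) : F x.1 ≠ F x.2 := by
  refine fun heq => hx.1 (injOn_ball_injRadius x.1 (Metric.mem_ball_self ?_) ?_ heq)
  · exact dist_nonneg.trans_lt hx.2
  · exact Metric.mem_ball'.2 hx.2

theorem discCoord_div_discRadius {x : ℍ × ℍ} (hx : x ∈ nearPairs F) :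
    discCoord x.1 x.2 / discRadius F x.1 ≠ 0 ∧ ‖discCoord x.1 x.2 / discRadius F x.1‖ < 1 := by
  have hlt := norm_discCoord_lt_discRadius.2 hx.2
  have hpos : 0 < discRadius F x.1 := (norm_nonneg _).trans_lt hlt
  refine ⟨div_ne_zero (discCoord_eq_zero.not.2 hx.1) (Complex.ofReal_ne_zero.2 hpos.ne'), ?_⟩
  rwa [norm_div, Complex.norm_real, Real.norm_of_nonneg hpos.le, div_lt_one hpos]

theorem ofReal_discRadius_ne_zero (hloc : ∀ p, ∃ U ∈ 𝓝 p, Set.InjOn F U) (p : ℍ) :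
    (discRadius F p : ℂ) ≠ 0 :=
  Complex.ofReal_ne_zero.2 (discRadius_pos hloc p).ne'

theorem dist_discPoint_lt (hloc : ∀ p, ∃ U ∈ 𝓝 p, Set.InjOn F U) (p : ℍ) {ζ : ℂ}
    (hζ : ‖ζ‖ < 1) : dist p (discPoint p (discRadius F p * ζ)) < injRadius F p := by
  rw [← norm_discCoord_lt_discRadius, discCoord_discPoint p (norm_discRadius_mul_lt_one p hζ),
    norm_mul, Complex.norm_real, Real.norm_of_nonneg (discRadius_pos hloc p).le]
  exact mul_lt_of_lt_one_right (discRadius_pos hloc p) hζ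

theorem injOn_map_discPoint (hloc : ∀ p, ∃ U ∈ 𝓝 p, Set.InjOn F U) (p : ℍ) :
    Set.InjOn (fun ζ : ℂ => F (discPoint p (discRadius F p * ζ))) {ζ | ‖ζ‖ < 1} := by
  intro ζ hζ ξ hξ h
  have hpoint := injOn_ball_injRadius p (Metric.mem_ball'.2 (dist_discPoint_lt hloc p hζ))
    (Metric.mem_ball'.2 (dist_discPoint_lt hloc p hξ)) h
  exact mul_left_cancel₀ (ofReal_discRadius_ne_zero hloc p) (injOn_discPoint p
    (norm_discRadius_mul_lt_one p hζ) (norm_discRadius_mul_lt_one p hξ) hpoint)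

theorem discPoint_mem_nearPairs (hloc : ∀ p, ∃ U ∈ 𝓝 p, Set.InjOn F U) (p : ℍ) {ζ : ℂ}
    (h0 : ζ ≠ 0) (h1 : ‖ζ‖ < 1) : (p, discPoint p (discRadius F p * ζ)) ∈ nearPairs F := by
  refine ⟨fun heq => mul_ne_zero (ofReal_discRadius_ne_zero hloc p) h0 ?_,
    dist_discPoint_lt hloc p h1⟩
  rw [← discCoord_discPoint p (norm_discRadius_mul_lt_one p h1), discCoord_eq_zero.2 heq]

theorem isConnected_nearPairs (hloc : ∀ p, ∃ U ∈ 𝓝 p, Set.InjOn F U) :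
    IsConnected (nearPairs F) := by
  have hcont : Continuous fun x : ℍ × ℍ =>
      (x.1, discPoint x.1 (discRadius F x.1 * Complex.exp (Complex.I * x.2))) := by
    have := UpperHalfPlane.continuous_coe
    have := continuous_discRadius (F := F)
    exact continuous_fst.prodMk (continuousOn_discPoint.comp_continuous
      (f := fun x : ℍ × ℍ => (x.1, (discRadius F x.1 * Complex.exp (Complex.I * x.2) : ℂ)))
      (by fun_prop) fun x => norm_discRadius_mul_lt_one x.1 (norm_exp_I_mul_lt_one x.2))
  convert isConnected_range hcont
  ext ⟨p, q⟩
  constructor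
  · intro hx
    obtain ⟨h0, h1⟩ := discCoord_div_discRadius hx
    obtain ⟨z, hz⟩ := exists_exp_I_mul_eq h0 h1
    refine ⟨(p, z), Prod.ext rfl ?_⟩
    simp only [hz]
    rw [mul_div_cancel₀ _ (ofReal_discRadius_ne_zero hloc p), discPoint_discCoord]
  · rintro ⟨⟨p', z⟩, heq⟩
    rw [← heq]
    exact discPoint_mem_nearPairs hloc p' (Complex.exp_ne_zero _) (norm_exp_I_mul_lt_one z)

/-- `h` is a continuous square root, near the diagonal, of the increment of `F` from `p` to `q`
divided by the tangent vector at `p` pointing towards `q`.  By `tangentCoord_smul` such roots are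
sections of a spin structure: under an isometry they change by the automorphy factor `denom`, up
to sign. -/
structure IsSpinRoot (F : ℍ → ℂ) (h : ℍ × ℍ → ℂ) : Prop where
  continuousOn : ContinuousOn h (nearPairs F)
  sq_mul (x) (hx : x ∈ nearPairs F) : h x ^ 2 * tangentCoord x.1 x.2 = F x.2 - F x.1

theorem IsSpinRoot.ne_zero (hh : IsSpinRoot F h) {x : ℍ × ℍ} (hx : x ∈ nearPairs F) : h x ≠ 0 := by
  refine fun h0 => map_ne_of_mem_nearPairs hx (sub_eq_zero.1 ?_).symm
  rw [← hh.sq_mul x hx, h0]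
  ring

theorem exists_isSpinRoot (hF : Continuous F) (hloc : ∀ p, ∃ U ∈ 𝓝 p, Set.InjOn F U) :
    ∃ h, IsSpinRoot F h := by
  have := UpperHalfPlane.continuous_im
  have hradius := continuous_discRadius (F := F)
  have hcoord := continuous_discCoord
  have hne := ofReal_discRadius_ne_zero hloc
  have hcont : ContinuousOn (fun y : ℍ × ℂ => F (discPoint y.1 (discRadius F y.1 * y.2)))
      {y | ‖y.2‖ < 1} :=
    hF.comp_continuousOn (continuousOn_discPoint.comp
      (f := fun y : ℍ × ℂ => (y.1, (discRadius F y.1 * y.2 : ℂ))) (by fun_prop)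
      fun y hy => norm_discRadius_mul_lt_one y.1 hy)
  obtain ⟨k, hk, hsq⟩ := exists_sqrt_sub_div hcont (injOn_map_discPoint hloc)
  obtain ⟨s, hs, hs_sq⟩ : ∃ s : ℍ → ℂ, Continuous s ∧ ∀ p, s p ^ 2 = discRadius F p * p.im :=
    ⟨fun p => √(discRadius F p * p.im), by fun_prop, fun p => by
      rw [← Complex.ofReal_pow, Real.sq_sqrt (mul_nonneg (discRadius_pos hloc p).le p.im_pos.le),
        Complex.ofReal_mul]⟩
  have hs0 (p) : s p ≠ 0 := by
    refine fun h => mul_ne_zero (hne p) (Complex.ofReal_ne_zero.2 p.im_ne_zero) ?_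
    rw [← hs_sq, h, zero_pow two_ne_zero]
  refine ⟨fun x => k (x.1, discCoord x.1 x.2 / discRadius F x.1) / s x.1, ?_, fun x hx => ?_⟩
  · refine (hk.comp (f := fun x : ℍ × ℍ => (x.1, discCoord x.1 x.2 / (discRadius F x.1 : ℂ)))
      (Continuous.continuousOn ?_) fun x hx => discCoord_div_discRadius hx).div
      (by fun_prop) fun x _ => hs0 x.1
    exact continuous_fst.prodMk (hcoord.div (by fun_prop) fun x => hne x.1)
  · have root := hsq x.1 _ (discCoord_div_discRadius hx).1 (discCoord_div_discRadius hx).2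
    rw [mul_div_cancel₀ _ (hne _), discPoint_discCoord, mul_zero, discPoint_zero] at root
    have him0 := Complex.ofReal_ne_zero.2 x.1.im_ne_zero
    rw [← root, tangentCoord, div_pow, hs_sq]
    field_simp [hne x.1]

theorem smul_mem_nearPairs (hF : ∀ p, F (g • p) = F p) {x : ℍ × ℍ} (hx : x ∈ nearPairs F) :
    g • x ∈ nearPairs F :=
  ⟨fun h => hx.1 (smul_left_cancel g h), by
    rw [Prod.smul_fst, Prod.smul_snd, dist_smul, injRadius_smul hF]; exact hx.2⟩

/-- `F` is invariant under `g`, and `h` transforms under `g` with the automorphy factor itself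
rather than with its negative.  This singles out one of the two lifts `g`, `-g` of an isometry. -/
def IsSpinLift (F : ℍ → ℂ) (h : ℍ × ℍ → ℂ) (g : SpecialLinearGroup (Fin 2) ℝ) : Prop :=
  (∀ p, F (g • p) = F p) ∧ ∀ x ∈ nearPairs F, h (g • x) = denom g x.1 * h x

theorem IsSpinLift.mul (hg : IsSpinLift F h g) (hg' : IsSpinLift F h g') :
    IsSpinLift F h (g * g') := by
  refine ⟨fun p => by rw [mul_smul, hg.1, hg'.1], fun x hx => ?_⟩
  rw [mul_smul, hg.2 _ (smul_mem_nearPairs hg'.1 hx), hg'.2 x hx, Prod.smul_fst, denom_mul,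
    mul_assoc]

theorem IsSpinLift.inv (hg : IsSpinLift F h g) : IsSpinLift F h g⁻¹ := by
  have hF (p) : F (g⁻¹ • p) = F p := by rw [← hg.1, smul_inv_smul]
  refine ⟨hF, fun x hx => ?_⟩
  have hcancel : denom (toGL g⁻¹) x.1 * denom g (g⁻¹ • x.1 : ℍ) = 1 := by
    rw [mul_comm, ← denom_mul, mul_inv_cancel]
    simp [denom]
  have hx' := hg.2 _ (smul_mem_nearPairs hF hx)
  rw [smul_inv_smul, Prod.smul_fst] at hx'
  rw [hx', ← mul_assoc, hcancel, one_mul]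

theorem IsSpinRoot.isSpinLift_or_neg (hh : IsSpinRoot F h)
    (hloc : ∀ p, ∃ U ∈ 𝓝 p, Set.InjOn F U) (hF : ∀ p, F (g • p) = F p) :
    IsSpinLift F h g ∨ IsSpinLift F h (-g) := by
  have : ConnectedSpace (nearPairs F) := Subtype.connectedSpace (isConnected_nearPairs hloc)
  have hcont : Continuous fun x : nearPairs F => h x := hh.continuousOn.domRestrict
  have hdenom := continuous_denom g
  have squares (x : nearPairs F) : h (g • x.1) ^ 2 = 1 * (denom g x.1.1 * h x.1) ^ 2 := by
    have root := hh.sq_mul _ (smul_mem_nearPairs hF x.2)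
    rw [Prod.smul_fst, Prod.smul_snd, hF, hF, ← hh.sq_mul _ x.2] at root
    apply mul_right_cancel₀ (tangentCoord_ne_zero (smul_mem_nearPairs hF x.2).1)
    rw [Prod.smul_fst, Prod.smul_snd]
    linear_combination root - h x.1 ^ 2 * tangentCoord_smul g x.1.1 x.1.2
  obtain ⟨ε, hε, hratio⟩ := exists_const_ratio (X := nearPairs F)
    (u := fun x => h (g • x.1)) (v := fun x => denom g x.1.1 * h x.1)
    (hh.continuousOn.comp_continuous (by fun_prop) fun x => smul_mem_nearPairs hF x.2)
    ((hdenom.comp (by fun_prop)).mul hcont)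
    (fun x => mul_ne_zero (denom_ne_zero g x.1.1) (hh.ne_zero x.2)) one_ne_zero squares
  rcases sq_eq_one_iff.1 hε with rfl | rfl
  · exact .inl ⟨hF, fun x hx => by simpa using hratio ⟨x, hx⟩⟩
  · refine .inr ⟨fun p => by rw [neg_smul_eq_smul, hF], fun x hx => ?_⟩
    have hneg : -g • x = g • x := Prod.ext (neg_smul_eq_smul g _) (neg_smul_eq_smul g _)
    rw [hneg, toGL_neg, denom_neg, neg_mul, ← neg_one_mul]
    exact hratio ⟨x, hx⟩

end SpinRoots

section NegativeTrace

variable {F : ℍ → ℂ} {h : ℍ × ℍ → ℂ} {g : SpecialLinearGroup (Fin 2) ℝ} {c : ℝ → ℍ} {z₀ ω : ℂ}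

/-- The point of the unit circle reached after `t` anticlockwise turns from `1`. -/
noncomputable def turn (t : ℝ) : ℂ := Complex.exp (2 * Real.pi * t * Complex.I)

theorem continuous_turn : Continuous turn := by
  unfold turn
  fun_prop

theorem turn_add (s t : ℝ) : turn (s + t) = turn s * turn t := by
  rw [turn, turn, turn, ← Complex.exp_add]
  push_cast
  ring_nf

theorem turn_ne_zero (t : ℝ) : turn t ≠ 0 := Complex.exp_ne_zero _

theorem norm_turn (t : ℝ) : ‖turn t‖ = 1 := by
  rw [turn, ← Complex.norm_exp_ofReal_mul_I (2 * Real.pi * t)]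
  push_cast
  rfl

theorem turn_zero : turn 0 = 1 := by simp [turn]

theorem turn_one : turn 1 = 1 := by simp [turn, Complex.exp_two_pi_mul_I]

theorem turn_half : turn (1 / 2) = -1 := by
  rw [turn, ← Complex.exp_pi_mul_I]
  push_cast
  ring_nf

theorem turn_ne_one {s : ℝ} (h0 : 0 < s) (h1 : s < 1) : turn s ≠ 1 := by
  intro h
  obtain ⟨n, hn⟩ := Complex.exp_eq_one_iff.1 h
  have hs : s = n := by
    have : (s : ℂ) = n := mul_right_cancel₀ Complex.two_pi_I_ne_zero (by rw [← hn]; ring)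
    exact_mod_cast this
  rw [hs] at h0 h1
  norm_cast at h0 h1
  omega

/-- `c` is a curve over a round circle, run once anticlockwise in unit time, whose ends differ by
the isometry `g`. -/
structure IsCircleLift (F : ℍ → ℂ) (g : SpecialLinearGroup (Fin 2) ℝ) (c : ℝ → ℍ) (z₀ ω : ℂ) :
    Prop where
  continuous : Continuous c
  add_one (t) : c (t + 1) = g • c t
  map_eq (t) : F (c t) = z₀ + ω * turn t
  radius_ne_zero : ω ≠ 0

theorem IsCircleLift.map_sub_map (hc : IsCircleLift F g c z₀ ω) (t s : ℝ) :
    F (c (t + s)) - F (c t) = ω * (turn s - 1) * turn t := by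
  rw [hc.map_eq, hc.map_eq, turn_add]
  ring

theorem IsCircleLift.ne_add (hc : IsCircleLift F g c z₀ ω) (hfix : ∀ p : ℍ, g • p ≠ p) (t : ℝ)
    {s : ℝ} (h0 : 0 < s) (h1 : s ≤ 1) : c t ≠ c (t + s) := by
  intro heq
  rcases h1.lt_or_eq with h1 | rfl
  · refine mul_ne_zero (mul_ne_zero hc.radius_ne_zero (sub_ne_zero.2 (turn_ne_one h0 h1)))
      (turn_ne_zero t) ?_
    rw [← hc.map_sub_map, heq, sub_self]
  · exact hfix (c t) (by rw [← hc.add_one, ← heq])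

theorem IsCircleLift.exists_sqrt_tangentCoord (hc : IsCircleLift F g c z₀ ω)
    (hfix : ∀ p : ℍ, g • p ≠ p) : ∃ k : ℝ × ℝ → ℂ, Continuous k ∧
      ∀ t u, k (t, u) ^ 2 = tangentCoord (c t) (c (t + min 1 (Real.exp u))) := by
  have := hc.continuous
  obtain ⟨k, hk, hsq⟩ := exists_sqrt (X := ℝ × ℝ)
    (f := fun x => tangentCoord (c x.1) (c (x.1 + min 1 (Real.exp x.2))))
    (continuous_tangentCoord.comp (Continuous.prodMk (by fun_prop) (by fun_prop)))
    fun x => tangentCoord_ne_zero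
      (hc.ne_add hfix x.1 (lt_min one_pos (Real.exp_pos _)) (min_le_left _ _))
  exact ⟨k, hk, fun t u => hsq (t, u)⟩

theorem IsCircleLift.eventually_dist_lt (hc : IsCircleLift F g c z₀ ω)
    (hloc : ∀ p, ∃ U ∈ 𝓝 p, Set.InjOn F U) :
    ∀ᶠ s in 𝓝 (0 : ℝ), ∀ t ∈ Set.Icc (0 : ℝ) 1, dist (c t) (c (t + s)) < injRadius F (c t) := by
  have := hc.continuous
  have := continuous_injRadius (F := F)
  refine isCompact_Icc.eventually_forall_of_forall_eventually fun t _ => ?_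
  refine (isOpen_lt (f := fun z : ℝ × ℝ => dist (c z.2) (c (z.2 + z.1)))
    (g := fun z => injRadius F (c z.2)) (by fun_prop) (by fun_prop)).mem_nhds ?_
  simpa using injRadius_pos hloc (c t)

/-- The square of `h · k` is constant times `turn`, so that `h · k` changes sign along the circle;
since `h` does not, `k` does. -/
theorem IsCircleLift.sign_eq_neg_one (hc : IsCircleLift F g c z₀ ω) (hfix : ∀ p : ℍ, g • p ≠ p)
    (hloc : ∀ p, ∃ U ∈ 𝓝 p, Set.InjOn F U) (hh : IsSpinRoot F h) (hg : IsSpinLift F h g)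
    {k : ℝ × ℝ → ℂ} (hk : Continuous k)
    (hsq : ∀ t u, k (t, u) ^ 2 = tangentCoord (c t) (c (t + min 1 (Real.exp u)))) {σ : ℂ}
    (hσ : ∀ t u, denom g (c t) * k (t + 1, u) = σ * k (t, u)) : σ = -1 := by
  have hcont := hc.continuous
  obtain ⟨s, hs, hs0, hs1⟩ := (((hc.eventually_dist_lt hloc).filter_mono nhdsWithin_le_nhds).and
    (Ioo_mem_nhdsGT (zero_lt_one' ℝ))).exists
  have near (t : Set.Icc (0 : ℝ) 1) : (c t, c (t + s)) ∈ nearPairs F :=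
    ⟨hc.ne_add hfix _ hs0 hs1.le, hs t t.2⟩
  have hsq' (t : ℝ) : k (t, Real.log s) ^ 2 = tangentCoord (c t) (c (t + s)) := by
    rw [hsq, Real.exp_log hs0, min_eq_right hs1.le]
  have hk0 : k (0, Real.log s) ≠ 0 := fun h0 =>
    tangentCoord_ne_zero (hc.ne_add hfix 0 hs0 hs1.le) (by rw [← hsq', h0, zero_pow two_ne_zero])
  obtain ⟨ε, -, hε⟩ := exists_const_ratio (X := Set.Icc (0 : ℝ) 1) (c := ω * (turn s - 1))
    (u := fun t => h (c t, c (t + s)) * k (t, Real.log s)) (v := fun t => turn (t / 2))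
    ((hh.continuousOn.comp_continuous (by fun_prop) near).mul (by fun_prop))
    (continuous_turn.comp (by fun_prop)) (fun t => turn_ne_zero _)
    (mul_ne_zero hc.radius_ne_zero (sub_ne_zero.2 (turn_ne_one hs0 hs1)))
    fun t => by rw [mul_pow, hsq', hh.sq_mul _ (near t), hc.map_sub_map, sq, ← turn_add, add_halves]
  have start := hε 0
  have finish := hε 1
  simp only [Set.Icc.coe_zero, Set.Icc.coe_one, zero_div, turn_half, zero_add] at start finish
  have spin := hg.2 _ (near 0)
  have tangent := hσ 0 (Real.log s)
  simp only [Set.Icc.coe_zero, zero_add, Prod.smul_mk, ← hc.add_one] at spin tangent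
  have h0 := hh.ne_zero (near 0)
  simp only [Set.Icc.coe_zero, zero_add] at h0
  rw [add_comm, spin] at finish
  rw [turn_zero] at start
  apply mul_right_cancel₀ (mul_ne_zero h0 hk0)
  linear_combination finish + start - h (c 0, c s) * tangent

theorem IsCircleLift.exists_antiperiodic_sqrt_tangentCoord (hc : IsCircleLift F g c z₀ ω)
    (hfix : ∀ p : ℍ, g • p ≠ p) (hloc : ∀ p, ∃ U ∈ 𝓝 p, Set.InjOn F U) (hh : IsSpinRoot F h)
    (hg : IsSpinLift F h g) : ∃ k : ℝ → ℂ, Continuous k ∧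
      (∀ t, k t ^ 2 = tangentCoord (c t) (g • c t)) ∧
      ∀ t, denom g (c t) * k (t + 1) = -k t := by
  have hcont := hc.continuous
  have hdenom := (continuous_denom g).comp hcont
  obtain ⟨k, hk, hsq⟩ := hc.exists_sqrt_tangentCoord hfix
  have hk0 (x) : k x ≠ 0 := fun h0 => tangentCoord_ne_zero (hc.ne_add hfix x.1
    (lt_min one_pos (Real.exp_pos x.2)) (min_le_left _ _)) (by rw [← hsq, h0, zero_pow two_ne_zero])
  obtain ⟨σ, -, hσ⟩ := exists_const_ratio (X := ℝ × ℝ) (c := 1)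
    (u := fun x => denom g (c x.1) * k (x.1 + 1, x.2)) (v := k)
    ((hdenom.comp continuous_fst).mul (by fun_prop)) hk hk0 one_ne_zero fun x => by
      rw [mul_pow, hsq, hsq, add_right_comm, hc.add_one, hc.add_one, mul_comm, tangentCoord_smul,
        one_mul]
  obtain rfl := hc.sign_eq_neg_one hfix hloc hh hg hk hsq fun t u => hσ (t, u)
  refine ⟨fun t => k (t, 0), by fun_prop, fun t => ?_, fun t => by simpa using hσ (t, 0)⟩
  rw [hsq, Real.exp_zero, min_self, hc.add_one]

theorem four_le_trace_sq (hfix : ∀ p : ℍ, g • p ≠ p) : 4 ≤ g.1.trace ^ 2 := by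
  by_contra! hlt
  have hell : (toGL g).IsElliptic := by
    change g.1.discr < 0
    rw [discr_fin_two, g.2]
    linarith
  exact hfix _ ((gl_smul_eq_self_iff_eq_fixedPt (by simp) hell).2 rfl)

theorem exists_mulVec_eq_smul (h2 : 2 ≤ g.1.trace) :
    ∃ (ν : ℝ) (v : Fin 2 → ℝ), 0 < ν ∧ ν ≤ 1 ∧ v ≠ 0 ∧ g.1 *ᵥ v = ν • v := by
  set t := g.1.trace with ht
  have hsq : √(t ^ 2 - 4) ^ 2 = t ^ 2 - 4 := Real.sq_sqrt (by nlinarith)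
  have hnonneg := Real.sqrt_nonneg (t ^ 2 - 4)
  set s := √(t ^ 2 - 4)
  have hdet : (g.1 - Matrix.scalar (Fin 2) ((t - s) / 2)).det = 0 := by
    have hg := det_fin_two_eq_one g
    rw [trace_fin_two] at ht
    rw [det_fin_two]
    simp
    nlinarith
  obtain ⟨v, hv, hker⟩ := Matrix.exists_mulVec_eq_zero_iff.2 hdet
  refine ⟨(t - s) / 2, v, by nlinarith, by nlinarith, hv, ?_⟩
  rwa [sub_mulVec, scalar_apply, ← smul_one_eq_diagonal, smul_mulVec, one_mulVec,
    sub_eq_zero] at hker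

/-- The symplectic pairing of `v` with `(p, 1)`.  Its zero is the boundary point `v 0 / v 1`, and
`p.im / ‖pairing v p‖ ^ 2` measures the height of `p` above the horocycles based there. -/
noncomputable def pairing (v : Fin 2 → ℝ) (p : ℍ) : ℂ := v 0 - v 1 * p

theorem pairing_ne_zero {v : Fin 2 → ℝ} (hv : v ≠ 0) (p : ℍ) : pairing v p ≠ 0 := by
  have hne : ![-v 1, v 0] ≠ 0 := fun h => hv <| by
    ext i
    fin_cases i
    · exact congrFun h 1
    · exact neg_eq_zero.1 (congrFun h 0)
  convert linear_ne_zero p hne using 1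
  simp only [pairing, cons_val_zero, cons_val_one]
  push_cast
  ring

theorem denom_mul_pairing (g : SpecialLinearGroup (Fin 2) ℝ) (v : Fin 2 → ℝ) (p : ℍ) :
    denom g p * pairing (g.1 *ᵥ v) (g • p) = pairing v p := by
  have det : (g.1 0 0 * g.1 1 1 - g.1 0 1 * g.1 1 0 : ℂ) = 1 := by
    exact_mod_cast det_fin_two_eq_one g
  simp only [pairing, mulVec, dotProduct, Fin.sum_univ_two]
  push_cast
  linear_combination (v 0 - v 1 * p : ℂ) * det
    - (g.1 1 0 * v 0 + g.1 1 1 * v 1 : ℂ) * coe_smul_mul_denom g p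
    + (g.1 0 0 * v 0 + g.1 0 1 * v 1 : ℂ) * denom_eq g p

theorem one_sub_discCoord_mul_pairing (v : Fin 2 → ℝ) (p q : ℍ) :
    (1 - discCoord p q) * pairing v q = pairing v p - discCoord p q * conj (pairing v p) := by
  have := coe_sub_conj_ne_zero p q
  simp only [pairing, discCoord, map_sub, map_mul, Complex.conj_ofReal]
  field_simp
  ring

theorem im_mul_normSq_one_sub_discCoord (p q : ℍ) :
    q.im * ‖1 - discCoord p q‖ ^ 2 = p.im * (1 - ‖discCoord p q‖ ^ 2) := by
  have hpq := coe_sub_conj_ne_zero p q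
  have hW : 1 - discCoord p q = (p - conj (p : ℂ)) / (q - conj (p : ℂ)) := by
    rw [discCoord, one_sub_div hpq, sub_sub_sub_cancel_left]
  have hnorm : Complex.normSq (q - conj (p : ℂ)) ≠ 0 := Complex.normSq_eq_zero.not.2 hpq
  rw [hW, discCoord, ← Complex.normSq_eq_norm_sq, ← Complex.normSq_eq_norm_sq, map_div₀, map_div₀,
    one_sub_div hnorm, ← mul_div_assoc, ← mul_div_assoc]
  congr 1
  simp only [Complex.normSq_apply, Complex.sub_re, Complex.sub_im, Complex.conj_re,
    Complex.conj_im, coe_re, coe_im]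
  ring

/-- Moving along a ray towards the boundary point `v 0 / v 1` increases the height. -/
theorem im_mul_pairing_lt {v : Fin 2 → ℝ} {p q : ℍ} {r : ℝ} (hv : v ≠ 0) (hr : 0 < r)
    (hray : discCoord p q * conj (pairing v p) = r * pairing v p) :
    p.im * ‖pairing v q‖ ^ 2 < q.im * ‖pairing v p‖ ^ 2 := by
  have hE : 0 < ‖pairing v p‖ := norm_pos_iff.2 (pairing_ne_zero hv p)
  have hD : ‖discCoord p q‖ = r := by
    have := congrArg norm hray
    rw [norm_mul, norm_mul, Complex.norm_conj, Complex.norm_real, Real.norm_of_nonneg hr.le] at this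
    exact mul_right_cancel₀ hE.ne' this
  have hr1 : r < 1 := hD ▸ norm_discCoord_lt_one p q
  have hW : 0 < ‖1 - discCoord p q‖ ^ 2 :=
    pow_pos (norm_pos_iff.2 (one_sub_ne_zero_of_norm_lt_one (norm_discCoord_lt_one p q))) 2
  have hq : ‖1 - discCoord p q‖ * ‖pairing v q‖ = (1 - r) * ‖pairing v p‖ := by
    rw [← norm_mul, one_sub_discCoord_mul_pairing, hray, ← one_sub_mul, norm_mul]
    norm_cast
    rw [Real.norm_of_nonneg (sub_pos.2 hr1).le]
  refine lt_of_mul_lt_mul_left ?_ hW.le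
  calc ‖1 - discCoord p q‖ ^ 2 * (p.im * ‖pairing v q‖ ^ 2)
      = p.im * ‖pairing v p‖ ^ 2 * (1 - r) ^ 2 := by
        linear_combination p.im * (‖1 - discCoord p q‖ * ‖pairing v q‖
          + (1 - r) * ‖pairing v p‖) * hq
    _ < p.im * ‖pairing v p‖ ^ 2 * (1 - r ^ 2) := by
        have := p.im_pos
        gcongr
        nlinarith
    _ = ‖1 - discCoord p q‖ ^ 2 * (q.im * ‖pairing v p‖ ^ 2) := by
        linear_combination -‖pairing v p‖ ^ 2 * im_mul_normSq_one_sub_discCoord p q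
          + p.im * ‖pairing v p‖ ^ 2 * (‖discCoord p q‖ + r) * hD

theorem exists_im_eq_zero {w : ℝ → ℂ} (hw : Continuous w) {a : ℝ} (ha : 0 < a)
    (h : a * w 1 = -w 0) : ∃ t, (w t).im = 0 := by
  have him : a * (w 1).im = -(w 0).im := by
    rw [← Complex.im_ofReal_mul, h, Complex.neg_im]
  have hcont := Complex.continuous_im.comp hw
  rcases le_total (w 0).im 0 with h0 | h0
  · exact mem_range_of_exists_le_of_exists_ge hcont ⟨0, h0⟩ ⟨1, by by_contra!; nlinarith⟩
  · exact mem_range_of_exists_le_of_exists_ge hcont ⟨1, by by_contra!; nlinarith⟩ ⟨0, h0⟩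

theorem exists_ray_of_im_eq_zero {v : Fin 2 → ℝ} {p q : ℍ} {κ : ℂ} (hv : v ≠ 0) (hpq : p ≠ q)
    (hκ : κ ^ 2 = tangentCoord p q) (him : (κ * conj (pairing v p)).im = 0) :
    ∃ r : ℝ, 0 < r ∧ discCoord p q * conj (pairing v p) = r * pairing v p := by
  have hE := pairing_ne_zero hv p
  have hE' : conj (pairing v p) ≠ 0 := (map_ne_zero _).2 hE
  have hκ0 : κ ≠ 0 := fun h => tangentCoord_ne_zero hpq (by rw [← hκ, h, zero_pow two_ne_zero])
  obtain ⟨x, hx⟩ : ∃ x : ℝ, κ * conj (pairing v p) = x := ⟨_, Complex.ext rfl him⟩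
  have hx0 : x ≠ 0 := fun h => mul_ne_zero hκ0 hE' (by rw [hx, h, Complex.ofReal_zero])
  have hp := p.im_pos
  refine ⟨x ^ 2 / (p.im * ‖pairing v p‖ ^ 2), by positivity, ?_⟩
  have hp0 := Complex.ofReal_ne_zero.2 p.im_ne_zero
  push_cast
  rw [tangentCoord] at hκ
  rw [← Complex.mul_conj', ← hx]
  field_simp
  rw [hκ]
  ring

/-- Otherwise, for some `t`, the ray from `c t` through `g • c t` would end at a boundary fixed
point of `g` with eigenvalue at most one, although `g` cannot increase the height over it. -/
theorem trace_neg_of_antiperiodic_sqrt (hc : Continuous c) (hper : ∀ t, c (t + 1) = g • c t)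
    (hfix : ∀ p : ℍ, g • p ≠ p) {k : ℝ → ℂ} (hk : Continuous k)
    (hsq : ∀ t, k t ^ 2 = tangentCoord (c t) (g • c t))
    (hanti : ∀ t, denom g (c t) * k (t + 1) = -k t) : g.1.trace < 0 := by
  by_contra! htr
  obtain ⟨ν, v, hν0, hν1, hv, heigen⟩ := exists_mulVec_eq_smul (g := g)
    (by nlinarith [four_le_trace_sq hfix])
  have hpair (p : ℍ) : ν * denom g p * pairing v (g • p) = pairing v p := by
    rw [← denom_mul_pairing g v p, heigen]
    simp [pairing]
    ring
  obtain ⟨t, ht⟩ : ∃ t, (k t * conj (pairing v (c t))).im = 0 := by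
    have := UpperHalfPlane.continuous_coe
    have := Complex.continuous_conj
    have hd := denom_ne_zero g (c 0)
    refine exists_im_eq_zero (a := ν * ‖denom g (c 0)‖ ^ 2) ?_ (by positivity) ?_
    · unfold pairing
      fun_prop
    · have h1 := hanti 0
      have h2 := congrArg conj (hpair (c 0))
      have h3 : c 1 = g • c 0 := by rw [← hper, zero_add]
      simp only [map_mul, Complex.conj_ofReal] at h2
      push_cast
      rw [← Complex.mul_conj', h3]
      rw [zero_add] at h1
      linear_combination ν * conj (denom g (c 0)) * conj (pairing v (g • c 0)) * h1 - k 0 * h2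
  obtain ⟨r, hr, hray⟩ := exists_ray_of_im_eq_zero hv (hfix (c t)).symm (hsq t) ht
  have hlt := im_mul_pairing_lt hv hr hray
  have hd := norm_pos_iff.2 (denom_ne_zero g (c t))
  rw [im_smul_eq_div, ← hpair (c t), norm_mul, norm_mul, Complex.norm_real,
    Real.norm_of_nonneg hν0.le] at hlt
  refine hlt.not_ge ?_
  calc _ = (c t).im * ‖pairing v (g • c t)‖ ^ 2 * ν ^ 2 := by field_simp
    _ ≤ _ := mul_le_of_le_one_right (by positivity) (pow_le_one₀ hν0.le hν1)

theorem IsCircleLift.trace_neg (hc : IsCircleLift F g c z₀ ω) (hfix : ∀ p : ℍ, g • p ≠ p)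
    (hloc : ∀ p, ∃ U ∈ 𝓝 p, Set.InjOn F U) (hh : IsSpinRoot F h) (hg : IsSpinLift F h g) :
    g.1.trace < 0 := by
  obtain ⟨k, hk, hsq, hanti⟩ := hc.exists_antiperiodic_sqrt_tangentCoord hfix hloc hh hg
  exact trace_neg_of_antiperiodic_sqrt hc.continuous hc.add_one hfix hk hsq hanti

end NegativeTrace

section SymmetricSquare

variable (g h : SpecialLinearGroup (Fin 2) ℝ)

/-- The symmetric square of `g`, in the basis of real symmetric matrices in which the determinant
is the form `J` (up to a factor); see `hermSq`. -/
noncomputable def symSqMatrix : Matrix (Fin 3) (Fin 3) ℝ :=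
  !![g.1 0 0 ^ 2, √2 * (g.1 0 0 * g.1 0 1), -g.1 0 1 ^ 2;
    √2 * (g.1 0 0 * g.1 1 0), g.1 0 0 * g.1 1 1 + g.1 0 1 * g.1 1 0, -(√2 * (g.1 0 1 * g.1 1 1));
    -g.1 1 0 ^ 2, -(√2 * (g.1 1 0 * g.1 1 1)), g.1 1 1 ^ 2]

theorem sq_sqrt_two : √2 ^ 2 = (2 : ℝ) := Real.sq_sqrt zero_le_two

theorem dotProduct_J_mulVec (x y : Fin 3 → ℝ) :
    x ⬝ᵥ (J *ᵥ y) = x 0 * y 2 + x 1 * y 1 + x 2 * y 0 := by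
  simp [J, dotProduct, mulVec, Fin.sum_univ_three]

theorem det_symSqMatrix : (symSqMatrix g).det = 1 := by
  have : (symSqMatrix g).det = (g.1 0 0 * g.1 1 1 - g.1 0 1 * g.1 1 0) ^ 3 := by
    simp [symSqMatrix, det_fin_three]
    ring_nf
    rw [sq_sqrt_two]
    ring
  rw [this, det_fin_two_eq_one, one_pow]

theorem symSqMatrix_form : (symSqMatrix g)ᵀ * J * symSqMatrix g = J := by
  have det_sq : (g.1 0 0 * g.1 1 1 - g.1 0 1 * g.1 1 0) ^ 2 = 1 := by
    rw [det_fin_two_eq_one, one_pow]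
  ext i j
  fin_cases i <;> fin_cases j <;>
    simp [symSqMatrix, J, Matrix.mul_apply, Fin.sum_univ_three] <;>
    grind [sq_sqrt_two]

theorem symSqMatrix_mul : symSqMatrix (g * h) = symSqMatrix g * symSqMatrix h := by
  ext i j
  fin_cases i <;> fin_cases j <;>
    simp [symSqMatrix, Matrix.mul_apply, Fin.sum_univ_three, Fin.sum_univ_two] <;>
    grind [sq_sqrt_two]

/-- The homomorphism `SL(2,ℝ) → SO(2,1)` given by the symmetric square. -/
noncomputable def symSq : SpecialLinearGroup (Fin 2) ℝ →* SO21 :=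
  MonoidHom.mk' (fun g => ⟨⟨symSqMatrix g, det_symSqMatrix g⟩, symSqMatrix_form g⟩)
    fun g h => Subtype.ext (Subtype.ext (symSqMatrix_mul g h))

theorem coe_symSq : (symSq g).1.1 = symSqMatrix g := rfl

theorem symSq_neg : symSq (-g) = symSq g :=
  Subtype.ext (Subtype.ext (by simp [coe_symSq, symSqMatrix]))

theorem tr_symSq : tr (symSq g).1 = g.1.trace ^ 2 - 1 := by
  rw [tr, coe_symSq, trace_fin_three, trace_fin_two]
  simp only [symSqMatrix, of_apply, cons_val]
  linear_combination -det_fin_two_eq_one g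

/-- The Hermitian square `v v*` of the vector `v = (z, w)`, with its imaginary part dropped, in the
coordinates in which `SL(2,ℝ)` acts through `symSqMatrix`. -/
noncomputable def hermSq (z w : ℂ) : Fin 3 → ℝ :=
  ![-Complex.normSq z, -(√2 * (z * conj w).re), Complex.normSq w]

theorem symSqMatrix_mulVec_hermSq (z w : ℂ) : symSqMatrix g *ᵥ hermSq z w
    = hermSq (g.1 0 0 * z + g.1 0 1 * w) (g.1 1 0 * z + g.1 1 1 * w) := by
  ext i
  fin_cases i <;>
    simp [symSqMatrix, hermSq, mulVec, dotProduct, Fin.sum_univ_three, Complex.normSq_apply] <;>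
    grind [sq_sqrt_two]

theorem hermSq_mul_right (z w u : ℂ) :
    hermSq (z * u) (w * u) = Complex.normSq u • hermSq z w := by
  ext i
  fin_cases i <;> simp [hermSq, Complex.normSq_apply] <;> ring

theorem hermSq_form (z w : ℂ) :
    hermSq z w ⬝ᵥ (J *ᵥ hermSq z w) = -2 * (z * conj w).im ^ 2 := by
  rw [dotProduct_J_mulVec]
  simp [hermSq, Complex.normSq_apply]
  grind [sq_sqrt_two]

theorem hermSq_ofReal_form (a b c d : ℝ) :
    hermSq a c ⬝ᵥ (J *ᵥ hermSq b d) = -(a * d - b * c) ^ 2 := by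
  rw [dotProduct_J_mulVec]
  simp [hermSq, Complex.normSq_apply]
  grind [sq_sqrt_two]

end SymmetricSquare

section Hyperboloid

/-- The identification of the upper half plane with the hyperboloid. -/
noncomputable def toHyp (p : ℍ) : HypPlane :=
  ⟨(√2 * p.im)⁻¹ • hermSq p 1, by
    have := p.im_pos
    rw [mulVec_smul, dotProduct_smul, smul_dotProduct, hermSq_form]
    simp
    grind [sq_sqrt_two],
   by
    have hscale : 0 < (√2 * p.im)⁻¹ := inv_pos.2 (mul_pos (by positivity) p.im_pos)
    simpa [hermSq] using hscale⟩

theorem coe_toHyp (p : ℍ) : (toHyp p).1 = (√2 * p.im)⁻¹ • hermSq p 1 := rfl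

theorem symSqMatrix_mulVec_toHyp (g : SpecialLinearGroup (Fin 2) ℝ) (p : ℍ) :
    symSqMatrix g *ᵥ (toHyp p).1 = (toHyp (g • p)).1 := by
  have image : symSqMatrix g *ᵥ hermSq p 1 = ‖denom g p‖ ^ 2 • hermSq (g • p : ℍ) 1 := by
    rw [symSqMatrix_mulVec_hermSq, ← Complex.normSq_eq_norm_sq, ← hermSq_mul_right,
      coe_smul_mul_denom, denom_eq]
    simp only [mul_one, one_mul]
  have hp := p.im_ne_zero
  have hd := norm_ne_zero_iff.2 (denom_ne_zero g p)
  rw [coe_toHyp, coe_toHyp, mulVec_smul, image, smul_smul, im_smul_eq_div]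
  congr 1
  field_simp

theorem smul_toHyp {A : SO21₀} {g : SpecialLinearGroup (Fin 2) ℝ} (hg : symSq g = A.1) (p : ℍ) :
    A • toHyp p = toHyp (g • p) := by
  refine Subtype.ext (Eq.trans ?_ (symSqMatrix_mulVec_toHyp g p))
  rw [← coe_symSq, hg]
  rfl

theorem HypPlane.form_eq (z : HypPlane) : 2 * z.1 0 * z.1 2 + z.1 1 ^ 2 = -1 := by
  have := z.2.1
  rw [dotProduct_J_mulVec] at this
  linarith

theorem HypPlane.first_neg (z : HypPlane) : z.1 0 < 0 := by
  nlinarith [z.form_eq, z.2.2, sq_nonneg (z.1 1)]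

theorem continuous_toHyp : Continuous toHyp := by
  have := UpperHalfPlane.continuous_coe
  have := UpperHalfPlane.continuous_im
  have := Complex.continuous_normSq
  have := Complex.continuous_re
  have scale : Continuous fun p : ℍ => (√2 * p.im)⁻¹ := Continuous.inv₀ (by fun_prop)
    fun p => mul_ne_zero (by positivity) p.im_ne_zero
  refine Continuous.subtype_mk (scale.smul ?_) _
  exact Continuous.matrixVecCons (by fun_prop) (Continuous.matrixVecCons (by fun_prop)
    (Continuous.matrixVecCons (by fun_prop) continuous_const))

/-- The upper half plane and the hyperboloid, as homeomorphic models of the hyperbolic plane. -/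
noncomputable def hypHomeo : ℍ ≃ₜ HypPlane where
  toFun := toHyp
  invFun z := ⟨⟨-z.1 1 / (√2 * z.1 2), 1 / (√2 * z.1 2)⟩, by
    have := z.2.2
    change 0 < 1 / (√2 * z.1 2)
    positivity⟩
  left_inv p := by
    have := p.im_ne_zero
    apply UpperHalfPlane.ext
    apply Complex.ext <;> simp [coe_toHyp, hermSq] <;> field_simp
  right_inv z := by
    have := z.2.2
    have := z.form_eq
    apply Subtype.ext
    ext i
    fin_cases i <;>
      simp [coe_toHyp, hermSq, Complex.normSq_apply, UpperHalfPlane.im] <;> grind [sq_sqrt_two]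
  continuous_toFun := continuous_toHyp
  continuous_invFun := by
    rw [UpperHalfPlane.isEmbedding_coe.continuous_iff]
    have coord (i : Fin 3) : Continuous fun z : HypPlane => z.1 i :=
      (_root_.continuous_apply i).comp continuous_subtype_val
    have h0 (z : HypPlane) : √2 * z.1 2 ≠ 0 := mul_ne_zero (by positivity) z.2.2.ne'
    exact Complex.equivRealProdCLM.symm.continuous.comp
      (((coord 1).neg.div ((coord 2).const_mul _) h0).prodMk
        (continuous_const.div ((coord 2).const_mul _) h0))

end Hyperboloid

section Surjectivity

theorem nonneg_of_forall_pos_mul_add_pos {u v : ℝ} (h : ∀ t > 0, 0 < t * u + v) :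
    0 ≤ u ∧ 0 ≤ v := by
  have hu : 0 ≤ u := by
    by_contra! hu
    have := h ((|v| + 1) / -u) (div_pos (by positivity) (neg_pos.2 hu))
    rw [div_mul_eq_mul_div, mul_div_assoc, div_neg, div_self hu.ne] at this
    linarith [le_abs_self v]
  refine ⟨hu, le_of_forall_pos_le_add fun ε hε => ?_⟩
  have bound : ε / (1 + u) * u ≤ ε := by
    rw [div_mul_eq_mul_div, div_le_iff₀ (by positivity)]
    nlinarith
  linarith [h (ε / (1 + u)) (by positivity)]

theorem toHyp_sqrt_mul_I {t : ℝ} (ht : 0 < t) :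
    (toHyp ⟨⟨0, √t⟩, Real.sqrt_pos.2 ht⟩).1 = (√2 * √t)⁻¹ • (t • hermSq 1 0 + hermSq 0 1) := by
  rw [coe_toHyp]
  change (√2 * √t)⁻¹ • _ = _
  congr 1
  ext i
  fin_cases i <;> simp [hermSq, Complex.normSq_apply, Real.mul_self_sqrt ht.le]

theorem mulVec_hermSq_cone (A : SO21₀) :
    ((A.1.1.1 *ᵥ hermSq 1 0) 0 ≤ 0 ∧ 0 ≤ (A.1.1.1 *ᵥ hermSq 1 0) 2) ∧
      (A.1.1.1 *ᵥ hermSq 0 1) 0 ≤ 0 ∧ 0 ≤ (A.1.1.1 *ᵥ hermSq 0 1) 2 := by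
  have image (t : ℝ) (ht : 0 < t) (i : Fin 3) :
      (A • toHyp ⟨⟨0, √t⟩, Real.sqrt_pos.2 ht⟩).1 i
        = (√2 * √t)⁻¹ * (t * (A.1.1.1 *ᵥ hermSq 1 0) i + (A.1.1.1 *ᵥ hermSq 0 1) i) := by
    change (A.1.1.1 *ᵥ (toHyp _).1) i = _
    rw [toHyp_sqrt_mul_I ht, mulVec_smul, mulVec_add, mulVec_smul]
    simp only [Pi.smul_apply, Pi.add_apply, smul_eq_mul]
  have scale (t : ℝ) (ht : 0 < t) : 0 < (√2 * √t)⁻¹ := by positivity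
  have last := nonneg_of_forall_pos_mul_add_pos fun t ht =>
    pos_of_mul_pos_right (image t ht 2 ▸ (A • toHyp _).2.2) (scale t ht).le
  have first := nonneg_of_forall_pos_mul_add_pos (u := -(A.1.1.1 *ᵥ hermSq 1 0) 0)
    (v := -(A.1.1.1 *ᵥ hermSq 0 1) 0) fun t ht => by
      have := neg_of_mul_neg_right (image t ht 0 ▸ (A • toHyp _).first_neg) (scale t ht).le
      linarith
  exact ⟨⟨neg_nonneg.1 first.1, last.1⟩, neg_nonneg.1 first.2, last.2⟩

theorem exists_hermSq_eq {x : Fin 3 → ℝ} (hx : x ⬝ᵥ (J *ᵥ x) = 0) (h0 : x 0 ≤ 0) (h2 : 0 ≤ x 2) :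
    ∃ a c : ℝ, hermSq a c = x := by
  rw [dotProduct_J_mulVec] at hx
  have first := Real.sq_sqrt (neg_nonneg.2 h0)
  have last := Real.sq_sqrt h2
  have middle : x 1 ^ 2 = (√2 * (√(-x 0) * √(x 2))) ^ 2 := by
    rw [mul_pow, mul_pow, sq_sqrt_two, first, last]
    linarith
  rcases sq_eq_sq_iff_eq_or_eq_neg.1 middle with middle | middle
  · refine ⟨√(-x 0), -√(x 2), ?_⟩
    ext i
    fin_cases i <;> simp [hermSq, Complex.normSq_apply] <;> linarith
  · refine ⟨√(-x 0), √(x 2), ?_⟩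
    ext i
    fin_cases i <;> simp [hermSq, Complex.normSq_apply] <;> linarith

theorem exists_symSqMatrix_mulVec_eq {a b c d : ℝ}
    (h : hermSq a c ⬝ᵥ (J *ᵥ hermSq b d) = hermSq 1 0 ⬝ᵥ (J *ᵥ hermSq 0 1)) :
    ∃ g, symSqMatrix g *ᵥ hermSq 1 0 = hermSq a c ∧ symSqMatrix g *ᵥ hermSq 0 1 = hermSq b d := by
  have det_sq : (a * d - b * c) ^ 2 = 1 := by
    have := hermSq_ofReal_form 1 0 0 1
    push_cast at this
    rw [hermSq_ofReal_form, this] at h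
    linarith
  rcases sq_eq_one_iff.1 det_sq with hdet | hdet
  · refine ⟨⟨!![a, b; c, d], by rw [det_fin_two_of, hdet]⟩, ?_, ?_⟩ <;>
      exact (symSqMatrix_mulVec_hermSq _ _ _).trans (by simp)
  · refine ⟨⟨!![a, -b; c, -d], by rw [det_fin_two_of]; linarith⟩, ?_, ?_⟩ <;>
      exact (symSqMatrix_mulVec_hermSq _ _ _).trans (by simp [hermSq])

theorem dotProduct_J_mulVec_mulVec (A : SO21) (x y : Fin 3 → ℝ) :
    (A.1.1 *ᵥ x) ⬝ᵥ (J *ᵥ (A.1.1 *ᵥ y)) = x ⬝ᵥ (J *ᵥ y) := by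
  have hA : A.1.1ᵀ * J * A.1.1 = J := A.2
  rw [mulVec_mulVec, ← vecMul_transpose, ← dotProduct_mulVec, mulVec_mulVec, ← Matrix.mul_assoc,
    hA]

theorem eq_one_of_mulVec_hermSq {X : SO21} (h0 : X.1.1 *ᵥ hermSq 1 0 = hermSq 1 0)
    (h2 : X.1.1 *ᵥ hermSq 0 1 = hermSq 0 1) : X = 1 := by
  obtain ⟨x00, x10, x20⟩ : X.1.1 0 0 = 1 ∧ X.1.1 1 0 = 0 ∧ X.1.1 2 0 = 0 := by
    simpa [funext_iff, Fin.forall_fin_succ, hermSq, mulVec, dotProduct, Fin.sum_univ_three] using h0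
  obtain ⟨x02, x12, x22⟩ : X.1.1 0 2 = 0 ∧ X.1.1 1 2 = 0 ∧ X.1.1 2 2 = 1 := by
    simpa [funext_iff, Fin.forall_fin_succ, hermSq, mulVec, dotProduct, Fin.sum_univ_three] using h2
  have x21 : X.1.1 2 1 = 0 := by
    have := dotProduct_J_mulVec_mulVec X (hermSq 1 0) (Pi.single 1 1)
    rw [h0, dotProduct_J_mulVec, dotProduct_J_mulVec] at this
    simpa [hermSq] using this
  have x01 : X.1.1 0 1 = 0 := by
    have := dotProduct_J_mulVec_mulVec X (hermSq 0 1) (Pi.single 1 1)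
    rw [h2, dotProduct_J_mulVec, dotProduct_J_mulVec] at this
    simpa [hermSq] using this
  have x11 : X.1.1 1 1 = 1 := by
    have det := X.1.2
    rw [det_fin_three] at det
    simpa [x00, x10, x20, x02, x12, x22, x21, x01] using det
  refine Subtype.ext (Subtype.ext (Matrix.ext fun i j => ?_))
  fin_cases i <;> fin_cases j <;> simp [x00, x10, x20, x02, x12, x22, x21, x01, x11]

theorem inv_symSq_mul_mulVec {A : SO21} {g : SpecialLinearGroup (Fin 2) ℝ} {x : Fin 3 → ℝ}
    (h : symSqMatrix g *ᵥ x = A.1.1 *ᵥ x) : ((symSq g)⁻¹ * A).1.1 *ᵥ x = x := by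
  have hone : ((symSq g)⁻¹).1.1 * symSqMatrix g = 1 :=
    congrArg (fun X : SO21 => X.1.1) (inv_mul_cancel (symSq g))
  change (((symSq g)⁻¹).1.1 * A.1.1) *ᵥ x = x
  rw [← mulVec_mulVec, ← h, mulVec_mulVec, hone, one_mulVec]

theorem exists_symSq_eq (A : SO21₀) : ∃ g, symSq g = A.1 := by
  obtain ⟨⟨left0, left2⟩, right0, right2⟩ := mulVec_hermSq_cone A
  obtain ⟨a, c, hac⟩ := exists_hermSq_eq (by rw [form_mulVec, hermSq_form]; simp) left0 left2
  obtain ⟨b, d, hbd⟩ := exists_hermSq_eq (by rw [form_mulVec, hermSq_form]; simp) right0 right2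
  have pairing : hermSq a c ⬝ᵥ (J *ᵥ hermSq b d) = hermSq 1 0 ⬝ᵥ (J *ᵥ hermSq 0 1) := by
    rw [hac, hbd, dotProduct_J_mulVec_mulVec]
  obtain ⟨g, hg0, hg2⟩ := exists_symSqMatrix_mulVec_eq pairing
  refine ⟨g, inv_mul_eq_one.1 (eq_one_of_mulVec_hermSq ?_ ?_)⟩
  · exact inv_symSq_mul_mulVec (hg0.trans hac)
  · exact inv_symSq_mul_mulVec (hg2.trans hbd)

end Surjectivity

section Holonomy

theorem trace_inv_fin_two (g : SpecialLinearGroup (Fin 2) ℝ) : (g⁻¹).1.trace = g.1.trace := by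
  rw [coe_inv, adjugate_fin_two, trace_fin_two_of, trace_fin_two, add_comm]

/-- With `L` a logarithm of `F - a`, the continuous function `L (c t) - log (1 + u t) - 2πit` is
constant, where `F (c t) - a = ω (1 + u t) e^{2πit}` and `|u| < 1`. -/
theorem IsCircleLift.smul_zero_ne {F : ℍ → ℂ} {g : SpecialLinearGroup (Fin 2) ℝ} {c : ℝ → ℍ}
    {z₀ ω a : ℂ} (hc : IsCircleLift F g c z₀ ω) (hF : Continuous F) (ha : ∀ p, F p ≠ a)
    (hω : ‖z₀ - a‖ < ‖ω‖) : g • c 0 ≠ c 0 := by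
  intro hper
  obtain ⟨L, hL, hexp⟩ := exists_log (f := fun p => F p - a) (hF.sub continuous_const)
    fun p => sub_ne_zero.2 (ha p)
  let u (t : ℝ) : ℂ := (z₀ - a) / (ω * turn t)
  have hu : Continuous u := continuous_const.div (continuous_const.mul continuous_turn)
    fun t => mul_ne_zero hc.radius_ne_zero (turn_ne_zero t)
  have hslit (t : ℝ) : 1 + u t ∈ Complex.slitPlane := by
    refine Complex.mem_slitPlane_of_norm_lt_one ?_
    rwa [norm_div, norm_mul, norm_turn, mul_one, div_lt_one (norm_pos_iff.2 hc.radius_ne_zero)]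
  let m (t : ℝ) : ℂ := L (c t) - Complex.log (1 + u t) - 2 * Real.pi * t * Complex.I
  have hm : Continuous m := by
    have hlog := (continuous_const.add hu).clog hslit
    exact ((hL.comp hc.continuous).sub hlog).sub (by fun_prop)
  have hexpm (t : ℝ) : Complex.exp (m t) = ω := by
    have hfactor : F (c t) - a = ω * (1 + u t) * turn t := by
      have := turn_ne_zero t
      have := hc.radius_ne_zero
      rw [hc.map_eq]
      simp only [u]
      field_simp
      ring
    rw [Complex.exp_sub, Complex.exp_sub, hexp,
      Complex.exp_log (Complex.slitPlane_ne_zero (hslit t)),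
      ← turn, hfactor, div_right_comm, mul_div_cancel_right₀ _ (turn_ne_zero t),
      mul_div_cancel_right₀ _ (Complex.slitPlane_ne_zero (hslit t))]
  have hconst : m 1 = m 0 := Complex.isCoveringMap_exp.const_of_comp hm
    (fun t s => Subtype.ext ((hexpm t).trans (hexpm s).symm)) 1 0
  have hc1 : c 1 = c 0 := by rw [← hper, ← hc.add_one, zero_add]
  have hu1 : u 1 = u 0 := by simp only [u, turn_one, turn_zero]
  simp [m, hc1, hu1, Complex.I_ne_zero, Real.pi_ne_zero] at hconst

/-- A free homotopy of loops preserves the deck transformation relating the ends of a lift. -/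
theorem exists_equivariant_lift {E Y : Type*} [TopologicalSpace E] [TopologicalSpace Y] {P : E → Y}
    (cov : IsCoveringMap P) {m : E → E} (hm : Continuous m) (hPm : ∀ e, P (m e) = P e)
    {y₀ : Y} {e : E} (c : Path e (m e)) {a d : Path y₀ y₀} (hd : ∀ t, d t = P (c t))
    (had : a.Homotopic d) {H : ℝ × ℝ → Y} (hH : Continuous H)
    (hper : ∀ t s, H (t + 1, s) = H (t, s)) (ha : ∀ t : unitInterval, H (t, 0) = a t) :
    ∃ K : ℝ × ℝ → E, Continuous K ∧ (∀ x, P (K x) = H x) ∧ ∀ t s, K (t + 1, s) = m (K (t, s)) := by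
  have hd0 : d 0 = P e := by rw [hd, c.source]
  have ha0 : a 0 = P e := by rw [a.source, ← d.source, hd0]
  obtain ⟨K, ⟨hK0, hK⟩, -⟩ := cov.existsUnique_continuousMap_lifts (⟨H, hH⟩ : C(ℝ × ℝ, Y)) (0, 0) e
    (by rw [← ha0, ← ha]; rfl)
  have hKP (x) : P (K x) = H x := congrFun hK x
  have hend : K (1, 0) = m e := by
    have hc : c.toContinuousMap = cov.liftPath d.toContinuousMap e hd0 :=
      (cov.eq_liftPath_iff' _).2 ⟨funext fun t => (hd t).symm, c.source⟩
    have hbottom : (⟨fun t : unitInterval => K ((t : ℝ), 0), by fun_prop⟩ : C(unitInterval, E))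
        = cov.liftPath a.toContinuousMap e ha0 :=
      (cov.eq_liftPath_iff' _).2 ⟨funext fun t => (hKP _).trans (ha t), by simpa using hK0⟩
    have hsame := cov.liftPath_apply_one_eq_of_homotopicRel (γ₀ := a.toContinuousMap)
      (γ₁ := d.toContinuousMap) had e ha0 hd0
    rw [← hc, ← hbottom] at hsame
    simpa using hsame
  have hequiv := cov.eq_of_comp_eq (g₁ := fun x : ℝ × ℝ => K (x.1 + 1, x.2))
    (g₂ := fun x => m (K x)) (by fun_prop) (hm.comp K.continuous)
    (funext fun x => by simp only [Function.comp_apply, hPm, hKP, hper]) (0, 0)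
    (by simp only [zero_add, hend, hK0])
  exact ⟨K, K.continuous, hKP, fun t s => congrFun hequiv (t, s)⟩

/-- The loop `ℓ` is freely homotopic in `S` to the round circle with centre `z₀` through `z₀ + ω`,
run once anticlockwise. -/
def IsFreelyCircular (S : Set ℂ) (ℓ : unitInterval → ℂ) (z₀ ω : ℂ) : Prop :=
  ∃ H : ℝ × ℝ → ℂ, Continuous H ∧ (∀ x, H x ∈ S) ∧ (∀ t s, H (t + 1, s) = H (t, s)) ∧
    (∀ t : unitInterval, H (t, 0) = ℓ t) ∧ ∀ t, H (t, 1) = z₀ + ω * turn t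

variable {Y : Type*} [TopologicalSpace Y] {y₀ : Y} {ρ : FundamentalGroup Y y₀ →* SO21₀}
  {f : Quotient (MulAction.orbitRel ρ.range HypPlane) ≃ₜ Y} {φ : Y ≃ₜ stdPants}
  {δ : FundamentalGroup Y y₀} {g : SpecialLinearGroup (Fin 2) ℝ}

/-- The developing map of the hyperbolic structure `f` on `Y`: the universal covering of the
standard three holed sphere by the upper half plane. -/
noncomputable def projToPlane (f : Quotient (MulAction.orbitRel ρ.range HypPlane) ≃ₜ Y)
    (φ : Y ≃ₜ stdPants) (p : ℍ) : ℂ := φ (f (proj ρ.range (toHyp p)))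

theorem projToPlane_mem (p : ℍ) : projToPlane f φ p ∈ stdPants := (φ _).2

theorem isCoveringMap_proj (hq : IsQuotientCoveringMap (proj ρ.range) ρ.range) :
    IsCoveringMap fun z => f (proj ρ.range z) :=
  IsQuotientCoveringMap.isCoveringMap _ _ (hq.homeomorph_comp f)

theorem continuous_projToPlane (hq : IsQuotientCoveringMap (proj ρ.range) ρ.range) :
    Continuous (projToPlane f φ) :=
  continuous_subtype_val.comp (φ.continuous.comp ((isCoveringMap_proj hq).continuous.comp
    hypHomeo.continuous))

theorem exists_injOn_projToPlane (hq : IsQuotientCoveringMap (proj ρ.range) ρ.range) (p : ℍ) :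
    ∃ U ∈ 𝓝 p, Set.InjOn (projToPlane f φ) U := by
  have h : IsLocalHomeomorph ((fun z => f (proj ρ.range z)) ∘ hypHomeo) :=
    (isCoveringMap_proj hq).isLocalHomeomorph.comp hypHomeo.isLocalHomeomorph
  obtain ⟨e, he, hfe⟩ := h p
  refine ⟨e.source, e.open_source.mem_nhds he, fun x hx y hy hxy => e.injOn hx hy ?_⟩
  rw [← hfe]
  exact φ.injective (Subtype.ext hxy)

theorem proj_smul (hq : IsQuotientCoveringMap (proj ρ.range) ρ.range) (δ : FundamentalGroup Y y₀)
    (z : HypPlane) : proj ρ.range (ρ δ • z) = proj ρ.range z :=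
  hq.map_smul ⟨ρ δ, δ, rfl⟩

theorem projToPlane_smul (hq : IsQuotientCoveringMap (proj ρ.range) ρ.range)
    (hg : symSq g = (ρ δ).1) (p : ℍ) : projToPlane f φ (g • p) = projToPlane f φ p := by
  rw [projToPlane, ← smul_toHyp hg, proj_smul hq, projToPlane]

theorem smul_eq_of_smul_eq (hq : IsQuotientCoveringMap (proj ρ.range) ρ.range)
    (hg : symSq g = (ρ δ).1) {p : ℍ} (hp : g • p = p) (q : ℍ) : g • q = q := by
  have := hq.isCancelSMul
  have hfix : ρ δ • toHyp p = toHyp p := by rw [smul_toHyp hg, hp]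
  have hone : (⟨ρ δ, δ, rfl⟩ : ρ.range) = 1 := IsCancelSMul.eq_one_of_smul hfix
  refine hypHomeo.injective ((smul_toHyp hg q).symm.trans ?_)
  rw [show ρ δ = 1 from congrArg Subtype.val hone, one_smul]
  rfl

/-- The inverse enters because in `IsFuchsian` the path `c` over a loop `δ` runs from `ρ δ • x₀` to
`x₀`. -/
theorem exists_isCircleLift_inv (hq : IsQuotientCoveringMap (proj ρ.range) ρ.range)
    {x₀ : HypPlane} {c : Path (ρ δ • x₀) x₀} {a d : Path y₀ y₀}
    (hd : ∀ t, d t = f (proj ρ.range (c t))) (had : a.Homotopic d) {z₀ ω : ℂ} (hω : ω ≠ 0)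
    (ha : IsFreelyCircular stdPants (fun t => φ (a t)) z₀ ω) (hg : symSq g = (ρ δ).1) :
    ∃ k, IsCircleLift (projToPlane f φ) g⁻¹ k z₀ ω := by
  obtain ⟨H, hH, hmem, hper, hstart, hcirc⟩ := ha
  have := hq.toContinuousConstSMul
  have hginv : symSq g⁻¹ = (ρ δ⁻¹).1 := by rw [map_inv, hg, map_inv]; rfl
  obtain ⟨K, hK, hKP, hKper⟩ := exists_equivariant_lift (isCoveringMap_proj (f := f) hq)
    (m := fun z => ρ δ⁻¹ • z) (continuous_const_smul (⟨ρ δ⁻¹, δ⁻¹, rfl⟩ : ρ.range))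
    (fun z => congrArg f (proj_smul hq δ⁻¹ z)) (c.cast rfl (by rw [map_inv, inv_smul_smul])) hd had
    (H := fun x => φ.symm ⟨H x, hmem x⟩) (by fun_prop) (fun t s => by simp only [hper])
    (fun t => (φ.symm_apply_eq).2 (Subtype.ext (hstart t)))
  have hlift (t : ℝ) : toHyp (hypHomeo.symm (K (t, 1))) = K (t, 1) := hypHomeo.apply_symm_apply _
  refine ⟨fun t => hypHomeo.symm (K (t, 1)), by fun_prop, fun t => hypHomeo.injective ?_,
    fun t => ?_, hω⟩
  · calc toHyp (hypHomeo.symm (K (t + 1, 1))) = ρ δ⁻¹ • toHyp (hypHomeo.symm (K (t, 1))) := by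
          rw [hlift, hlift, hKper]
      _ = toHyp (g⁻¹ • hypHomeo.symm (K (t, 1))) := smul_toHyp hginv _
  · rw [projToPlane, hlift, hKP, φ.apply_symm_apply]
    exact hcirc t

theorem IsSpinLift.trace_neg_of_isFreelyCircular
    (hq : IsQuotientCoveringMap (proj ρ.range) ρ.range) {h : ℍ × ℍ → ℂ}
    (hh : IsSpinRoot (projToPlane f φ) h) (hg : symSq g = (ρ δ).1)
    (hspin : IsSpinLift (projToPlane f φ) h g) {x₀ : HypPlane} {c : Path (ρ δ • x₀) x₀}
    {a d : Path y₀ y₀} (hd : ∀ t, d t = f (proj ρ.range (c t))) (had : a.Homotopic d)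
    {z₀ ω v : ℂ} (ha : IsFreelyCircular stdPants (fun t => φ (a t)) z₀ ω) (hv : v ∉ stdPants)
    (hω : ‖z₀ - v‖ < ‖ω‖) : g.1.trace < 0 := by
  obtain ⟨k, hk⟩ := exists_isCircleLift_inv hq hd had
    (norm_pos_iff.1 ((norm_nonneg _).trans_lt hω)) ha hg
  have hmoves := hk.smul_zero_ne (continuous_projToPlane hq)
    (fun p hp => hv (by rw [← hp]; exact projToPlane_mem p)) hω
  have hfix (p : ℍ) : g⁻¹ • p ≠ p := fun hp =>
    hmoves (inv_smul_eq_iff.2 (smul_eq_of_smul_eq hq hg (inv_smul_eq_iff.1 hp).symm _).symm)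
  rw [← trace_inv_fin_two]
  exact hk.trace_neg hfix (exists_injOn_projToPlane hq) hh hspin.inv

end Holonomy

section BoundaryCircles

theorem turn_add_one (t : ℝ) : turn (t + 1) = turn t := by rw [turn_add, turn_one, mul_one]

theorem turn_im (t : ℝ) : (turn t).im = Real.sin (2 * Real.pi * t) := by
  rw [turn, ← Complex.exp_ofReal_mul_I_im]
  push_cast
  rfl

theorem two_I_mul_turn_mul_im (t : ℝ) :
    2 * Complex.I * turn t * (turn t).im = turn (2 * t) - 1 := by
  have hconj : turn t * conj (turn t) = 1 := by simp [Complex.mul_conj', norm_turn]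
  have him : 2 * Complex.I * ((turn t).im : ℂ) = turn t - conj (turn t) := by
    rw [Complex.sub_conj]
    push_cast
    ring
  rw [two_mul t, turn_add]
  linear_combination turn t * him - hconj

theorem neg_one_add_mem_stdPants {w : ℂ} (hw : ‖w‖ = 1) : -1 + w ∈ stdPants := by
  refine ⟨?_, ?_, ?_⟩
  · have := norm_add_le (-1 : ℂ) w
    rw [norm_neg, norm_one, hw] at this
    linarith
  · rw [neg_add_cancel_comm, hw]
    norm_num
  · have := norm_sub_norm_le (2 : ℂ) w
    rw [hw, Complex.norm_ofNat] at this
    rw [show -1 + w - 1 = -(2 - w) by ring, norm_neg]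
    linarith

theorem neg_mem_stdPants {z : ℂ} (hz : z ∈ stdPants) : -z ∈ stdPants := by
  refine ⟨by rw [norm_neg]; exact hz.1, ?_, ?_⟩
  · rw [show -z + 1 = -(z - 1) by ring, norm_neg]
    exact hz.2.2
  · rw [show -z - 1 = -(z + 1) by ring, norm_neg]
    exact hz.2.1

theorem neg_one_notMem_stdPants : (-1 : ℂ) ∉ stdPants := by norm_num [stdPants]

theorem one_notMem_stdPants : (1 : ℂ) ∉ stdPants := by norm_num [stdPants]

theorem isFreelyCircular_of_eq {S : Set ℂ} {ℓ : unitInterval → ℂ} {z₀ ω : ℂ}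
    (hmem : ∀ t, z₀ + ω * turn t ∈ S) (hℓ : ∀ t : unitInterval, ℓ t = z₀ + ω * turn t) :
    IsFreelyCircular S ℓ z₀ ω :=
  ⟨fun x => z₀ + ω * turn x.1,
    continuous_const.add (continuous_const.mul (continuous_turn.comp continuous_fst)),
    fun x => hmem x.1, fun t _ => by simp only [turn_add_one], fun t => (hℓ t).symm, fun _ => rfl⟩

theorem isFreelyCircular_left {ℓ : unitInterval → ℂ} (hℓ : ∀ t, ℓ t = -1 + turn t) :
    IsFreelyCircular stdPants ℓ (-1) 1 :=
  isFreelyCircular_of_eq (fun t => by rw [one_mul]; exact neg_one_add_mem_stdPants (norm_turn t))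
    fun t => by rw [hℓ, one_mul]

theorem isFreelyCircular_right {ℓ : unitInterval → ℂ} (hℓ : ∀ t, ℓ t = 1 - turn t) :
    IsFreelyCircular stdPants ℓ 1 (-1) := by
  refine isFreelyCircular_of_eq (fun t => ?_) fun t => by rw [hℓ, neg_one_mul, sub_eq_add_neg]
  rw [show 1 + -1 * turn t = -(-1 + turn t) by ring]
  exact neg_mem_stdPants (neg_one_add_mem_stdPants (norm_turn t))

/-- The circles `|z ± 1| = 1` meet the ray from `0` through `i w` at distance `2 |Im w|`. -/
theorem radial_mem_stdPants {w : ℂ} (hw : ‖w‖ = 1) {r : ℝ} (h1 : |w.im| ≤ r) (h2 : r ≤ 1) :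
    2 * Complex.I * w * r ∈ stdPants := by
  have hr0 : 0 ≤ r := (abs_nonneg _).trans h1
  have hunit : w.re ^ 2 + w.im ^ 2 = 1 := by
    have := Complex.normSq_eq_norm_sq w
    rw [hw, Complex.normSq_apply] at this
    linarith
  have half_lt (z : ℂ) (hz : 1 ≤ Complex.normSq z) : 1 / 2 < ‖z‖ := by
    rw [Complex.normSq_eq_norm_sq] at hz
    nlinarith [norm_nonneg z]
  refine ⟨?_, half_lt _ ?_, half_lt _ ?_⟩
  · rw [norm_mul, norm_mul, norm_mul, hw, Complex.norm_I, Complex.norm_real,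
      Real.norm_of_nonneg hr0, Complex.norm_ofNat]
    linarith
  · have := mul_nonneg hr0 (sub_nonneg.2 (abs_le.1 h1).2)
    simp [Complex.normSq_apply]
    linear_combination 4 * this - 4 * r ^ 2 * hunit
  · have := mul_nonneg hr0 (neg_le_iff_add_nonneg.1 (abs_le.1 h1).1)
    simp [Complex.normSq_apply]
    linear_combination 4 * this - 4 * r ^ 2 * hunit

/-- The radial free homotopy from the concatenation of the circles `|z + 1| = 1` and `|z - 1| = 1`
to the circle `|z| = 2`. The second variable is clamped to the unit interval. -/
noncomputable def outerHomotopy (x : ℝ × ℝ) : ℂ :=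
  2 * Complex.I * turn x.1 *
    (((1 - max 0 (min x.2 1)) * |(turn x.1).im| + max 0 (min x.2 1) : ℝ) : ℂ)

theorem outerHomotopy_mem (x : ℝ × ℝ) : outerHomotopy x ∈ stdPants := by
  have hw := norm_turn x.1
  have him : |(turn x.1).im| ≤ 1 := (Complex.abs_im_le_norm _).trans hw.le
  have h0 : 0 ≤ max 0 (min x.2 1) := le_max_left _ _
  have h1 : max 0 (min x.2 1) ≤ 1 := max_le zero_le_one (min_le_right _ _)
  exact radial_mem_stdPants hw (by nlinarith) (by nlinarith)

theorem continuous_outerHomotopy : Continuous outerHomotopy := by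
  have := continuous_turn
  unfold outerHomotopy
  fun_prop

theorem outerHomotopy_zero_left {t : ℝ} (h0 : 0 ≤ t) (h1 : t ≤ 1 / 2) :
    outerHomotopy (t, 0) = -1 + turn (2 * t) := by
  have him : 0 ≤ (turn t).im := by
    rw [turn_im]
    exact Real.sin_nonneg_of_nonneg_of_le_pi (by positivity) (by nlinarith [Real.pi_pos])
  have := two_I_mul_turn_mul_im t
  simp only [outerHomotopy, abs_of_nonneg him, min_eq_left zero_le_one, max_self, sub_zero, one_mul,
    add_zero]
  linear_combination this

theorem outerHomotopy_zero_right {t : ℝ} (h0 : 1 / 2 ≤ t) (h1 : t ≤ 1) :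
    outerHomotopy (t, 0) = 1 - turn (2 * t - 1) := by
  have him : (turn t).im ≤ 0 := by
    have := Real.sin_nonneg_of_nonneg_of_le_pi (x := 2 * Real.pi * t - Real.pi)
      (by nlinarith [Real.pi_pos]) (by nlinarith [Real.pi_pos])
    rw [Real.sin_sub_pi] at this
    rw [turn_im]
    linarith
  have := two_I_mul_turn_mul_im t
  rw [← turn_add_one (2 * t - 1), sub_add_cancel]
  simp only [outerHomotopy, abs_of_nonpos him, min_eq_left zero_le_one, max_self, sub_zero, one_mul,
    add_zero, Complex.ofReal_neg]
  linear_combination -this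

theorem isFreelyCircular_trans {Y : Type*} [TopologicalSpace Y] {y₀ : Y} {φ : Y → ℂ}
    {a b : Path y₀ y₀} (ha : ∀ t, φ (a t) = -1 + turn t) (hb : ∀ t, φ (b t) = 1 - turn t) :
    IsFreelyCircular stdPants (fun t => φ (a.trans b t)) 0 (2 * Complex.I) := by
  refine ⟨outerHomotopy, continuous_outerHomotopy, outerHomotopy_mem,
    fun t s => by simp only [outerHomotopy, turn_add_one], fun t => ?_,
    fun t => by simp [outerHomotopy]⟩
  simp only [Path.trans_apply]
  split_ifs with ht
  · rw [ha, outerHomotopy_zero_left t.2.1 ht]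
  · rw [hb, outerHomotopy_zero_right (not_le.1 ht).le t.2.2]

end BoundaryCircles

section Traces

variable {Y : Type*} [TopologicalSpace Y] {y₀ : Y} {α β γ : FundamentalGroup Y y₀}
  {ρ : FundamentalGroup Y y₀ →* SO21₀}

theorem exists_isSpinLift_symSq_eq {f : Quotient (MulAction.orbitRel ρ.range HypPlane) ≃ₜ Y}
    {φ : Y ≃ₜ stdPants} (hq : IsQuotientCoveringMap (proj ρ.range) ρ.range) {h : ℍ × ℍ → ℂ}
    (hh : IsSpinRoot (projToPlane f φ) h) (δ : FundamentalGroup Y y₀) :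
    ∃ g, symSq g = (ρ δ).1 ∧ IsSpinLift (projToPlane f φ) h g := by
  obtain ⟨g, hg⟩ := exists_symSq_eq (ρ δ)
  rcases hh.isSpinLift_or_neg (exists_injOn_projToPlane hq) (projToPlane_smul hq hg) with hs | hs
  · exact ⟨g, hg, hs⟩
  · exact ⟨-g, (symSq_neg g).trans hg, hs⟩

theorem exists_symSq_eq_trace_neg (hY : IsThreeHoledSphere α β γ) (hρ : IsFuchsian ρ) :
    ∃ a b, symSq a = (ρ α).1 ∧ symSq b = (ρ β).1 ∧
      a.1.trace < 0 ∧ b.1.trace < 0 ∧ (b * a).1.trace < 0 := by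
  obtain ⟨φ, la, lb, hla, hlb, rfl, rfl, -⟩ := hY
  obtain ⟨hq, f, x₀, -, hpath⟩ := hρ
  obtain ⟨h, hh⟩ := exists_isSpinRoot (continuous_projToPlane (f := f) (φ := φ) hq)
    (exists_injOn_projToPlane hq)
  obtain ⟨a, ha, hsa⟩ := exists_isSpinLift_symSq_eq hq hh
    (FundamentalGroup.fromPath (Path.Homotopic.Quotient.mk la))
  obtain ⟨b, hb, hsb⟩ := exists_isSpinLift_symSq_eq hq hh
    (FundamentalGroup.fromPath (Path.Homotopic.Quotient.mk lb))
  have hba : symSq (b * a) =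
      (ρ (FundamentalGroup.fromPath (Path.Homotopic.Quotient.mk (la.trans lb)))).1 := by
    rw [map_mul, ha, hb, ← Subgroup.coe_mul, ← map_mul]
    rfl
  have trace_neg {l : Path y₀ y₀} {g : SpecialLinearGroup (Fin 2) ℝ} {z₀ ω v : ℂ}
      (hg : symSq g = (ρ (FundamentalGroup.fromPath (Path.Homotopic.Quotient.mk l))).1)
      (hs : IsSpinLift (projToPlane f φ) h g)
      (hl : IsFreelyCircular stdPants (fun t => φ (l t)) z₀ ω) (hv : v ∉ stdPants)
      (hω : ‖z₀ - v‖ < ‖ω‖) : g.1.trace < 0 := by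
    obtain ⟨c, d, hd, hdl⟩ := hpath (FundamentalGroup.fromPath (Path.Homotopic.Quotient.mk l))
    exact hs.trace_neg_of_isFreelyCircular hq hh hg hd (Path.Homotopic.Quotient.exact hdl.symm)
      hl hv hω
  exact ⟨a, b, ha, hb,
    trace_neg ha hsa (isFreelyCircular_left hla) neg_one_notMem_stdPants (by simp),
    trace_neg hb hsb (isFreelyCircular_right hlb) one_notMem_stdPants (by simp),
    trace_neg hba (hsb.mul hsa) (isFreelyCircular_trans (φ := fun y => φ y) hla hlb)
      one_notMem_stdPants (by simp)⟩

theorem trace_inv_mul_fin_two (g h : SpecialLinearGroup (Fin 2) ℝ) :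
    (g⁻¹ * h).1.trace = g.1.trace * h.1.trace - (h * g).1.trace := by
  simp only [coe_mul, coe_inv, adjugate_fin_two, trace_fin_two, mul_apply, Fin.sum_univ_two,
    of_apply, cons_val', cons_val_zero, cons_val_one, cons_val_fin_one]
  ring

theorem trace_commutator_fin_two (g h : SpecialLinearGroup (Fin 2) ℝ) :
    (g * h * g⁻¹ * h⁻¹).1.trace = g.1.trace ^ 2 + h.1.trace ^ 2 + (h * g).1.trace ^ 2
      - g.1.trace * h.1.trace * (h * g).1.trace - 2 := by
  have hg := det_fin_two_eq_one g
  have hh := det_fin_two_eq_one h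
  simp only [coe_mul, coe_inv, adjugate_fin_two, trace_fin_two, mul_apply, Fin.sum_univ_two,
    of_apply, cons_val', cons_val_zero, cons_val_one, cons_val_fin_one]
  linear_combination (g.1 0 0 + g.1 1 1) ^ 2 * hh + (h.1 0 0 + h.1 1 1) ^ 2 * hg
    - 2 * (hg * (h.1 0 0 * h.1 1 1 - h.1 0 1 * h.1 1 0) + hh)

theorem shapePlus_symSq (a b : SpecialLinearGroup (Fin 2) ℝ)
    (C : SpecialLinearGroup (Fin 3) ℝ) :
    shapePlus (symSq a).1 (symSq b).1 C = a.1.trace ^ 2 + b.1.trace ^ 2 + (b * a).1.trace ^ 2 - 2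
      - 2 * (a.1.trace * b.1.trace * (b * a).1.trace) := by
  rw [shapePlus, ← Subgroup.coe_inv, ← Subgroup.coe_mul, ← map_inv, ← map_mul, tr_symSq, tr_symSq,
    tr_symSq, trace_inv_fin_two, trace_inv_mul_fin_two]
  ring

theorem shapeMinus_symSq (a b : SpecialLinearGroup (Fin 2) ℝ)
    (C : SpecialLinearGroup (Fin 3) ℝ) :
    shapeMinus (symSq a).1 (symSq b).1 C = a.1.trace ^ 2 + b.1.trace ^ 2 + (b * a).1.trace ^ 2 - 2
      - 2 * (a.1.trace * b.1.trace * (b * a).1.trace) := by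
  have hcomm : (a * b).1.trace = (b * a).1.trace := by
    rw [coe_mul, coe_mul, trace_mul_comm]
  rw [show shapeMinus (symSq a).1 (symSq b).1 C = shapePlus (symSq b).1 (symSq a).1 C from rfl,
    shapePlus_symSq, hcomm]
  ring

theorem tr_commutator_symSq (a b : SpecialLinearGroup (Fin 2) ℝ) :
    tr ((symSq a).1 * (symSq b).1 * (symSq a).1⁻¹ * (symSq b).1⁻¹) =
      (a.1.trace ^ 2 + b.1.trace ^ 2 + (b * a).1.trace ^ 2 - 2
        - a.1.trace * b.1.trace * (b * a).1.trace) ^ 2 - 1 := by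
  rw [← Subgroup.coe_inv, ← Subgroup.coe_inv, ← Subgroup.coe_mul, ← Subgroup.coe_mul,
    ← Subgroup.coe_mul, ← map_inv, ← map_inv, ← map_mul, ← map_mul, ← map_mul, tr_symSq,
    trace_commutator_fin_two]
  ring

theorem tr_inv_mul_symSq (a b : SpecialLinearGroup (Fin 2) ℝ) :
    tr ((symSq b).1 * (symSq a).1)⁻¹ = (b * a).1.trace ^ 2 - 1 := by
  rw [← Subgroup.coe_mul, ← Subgroup.coe_inv, ← map_mul, ← map_inv, tr_symSq, trace_inv_fin_two]

theorem IsThreeHoledSphere.toSL_third (hY : IsThreeHoledSphere α β γ) :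
    toSL (ρ γ) = (toSL (ρ β) * toSL (ρ α))⁻¹ := by
  obtain ⟨-, -, -, -, -, -, -, h⟩ := hY
  rw [mul_assoc] at h
  rw [eq_inv_of_mul_eq_one_left h, map_inv, map_mul]
  rfl

theorem sqrt_sq_mul_sq_mul_sq_of_neg {x y z : ℝ} (hx : x < 0) (hy : y < 0) (hz : z < 0) :
    √(x ^ 2 * y ^ 2 * z ^ 2) = -(x * y * z) := by
  have hxyz : x * y * z < 0 := mul_neg_of_pos_of_neg (mul_pos_of_neg_of_neg hx hy) hz
  rw [← mul_pow, ← mul_pow, Real.sqrt_sq_eq_abs, abs_of_neg hxyz]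

end Traces

end Pants

open Pants in
theorem proposition5p10 {Y : Type*} [TopologicalSpace Y] {y₀ : Y}
    (α β γ : FundamentalGroup Y y₀) (hY : IsThreeHoledSphere α β γ)
    (ρ : FundamentalGroup Y y₀ →* SO21₀) (hρ : IsFuchsian ρ)
    (A B C : Matrix.SpecialLinearGroup (Fin 3) ℝ)
    (hA : A = toSL (ρ α)) (hB : B = toSL (ρ β)) (hC : C = toSL (ρ γ)) :
    0 < (tr A + 1) * (tr B + 1) * (tr C + 1) ∧
    shapePlus A B C = tr A + tr B + tr C + 1
      + 2 * Real.sqrt ((tr A + 1) * (tr B + 1) * (tr C + 1)) ∧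
    shapeMinus A B C = tr A + tr B + tr C + 1
      + 2 * Real.sqrt ((tr A + 1) * (tr B + 1) * (tr C + 1)) ∧
    tr (A * B * A⁻¹ * B⁻¹) = (tr A + tr B + tr C + 1
      + Real.sqrt ((tr A + 1) * (tr B + 1) * (tr C + 1))) ^ 2 - 1 := by
  obtain ⟨a, b, ha, hb, hx, hy, hz⟩ := exists_symSq_eq_trace_neg hY hρ
  have hC' : C = (B * A)⁻¹ := by rw [hC, hA, hB, hY.toSL_third]
  obtain rfl : A = (symSq a).1 := by rw [hA, ha, toSL]
  obtain rfl : B = (symSq b).1 := by rw [hB, hb, toSL]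
  have htrC : tr C = (b * a).1.trace ^ 2 - 1 := by rw [hC', tr_inv_mul_symSq]
  have hsqrt := sqrt_sq_mul_sq_mul_sq_of_neg hx hy hz
  simp only [htrC, tr_symSq, shapePlus_symSq, shapeMinus_symSq, tr_commutator_symSq,
    sub_add_cancel, hsqrt]
  have hx0 := hx.ne
  have hy0 := hy.ne
  have hz0 := hz.ne
  exact ⟨by positivity, by ring, by ring, by ring⟩
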